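/- Let $n\in\mathbb N$, $n\ge 1$, $Y=(0,1)^n$. Let $A\in L^\infty_{\mathrm{per}}(Y;\mathbb R^{n\times n}_{\mathrm{sym}})$ and $b\in L^\infty_{\mathrm{per}}(Y;\mathbb R^n)$ ($Y$-periodic) satisfy $\lambda I_n\le A\le\Lambda I_n$ a.e. for some $\lambda,\Lambda>0$, and, for some $\delta\in\left(\frac{n}{n+\pi^2},1\right]$, $$\frac{|A|^2+|b|^2}{(\operatorname{tr}A)^2}\le\frac1{n-1+\delta}\quad\text{a.e.},$$ where $|A|$ is the Frobenius norm. Set $\gamma:=\frac{\operatorname{tr}A}{|A|^2+|b|^2}$, $\tilde A:=\gamma A$, $\tilde b:=\gamma b$, and let $F\in L^2_{\mathrm{per}}(Y;\mathbb R^n)$. Let $H^1_{\mathrm{per},0}(Y;\mathbb R^n)$ be the space of $Y$-periodic $H^1$ vector fields with mean zero over $Y$ (with the $H^1(Y)$-norm), and for $v,w$ in it let $$B_2(v,w):=\int_Y(\nabla\cdot v)\,(\tilde A:Dw+\tilde b\cdot w)+\frac12\int_Y\left(Dv-(Dv)^{\mathrm T}\right):\left(Dw-(Dw)^{\mathrm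 T}\right).$$ There is a unique $\tilde\rho_0\in H^1_{\mathrm{per},0}(Y;\mathbb R^n)$ with $B_2(\tilde\rho_0,w)=-\int_YF\cdot w$ for all $w\in H^1_{\mathrm{per},0}(Y;\mathbb R^n)$. There is a unique $\tilde u_0\in L^2_{\mathrm{per}}(Y)$ solving $$-D^2:(\tilde A\tilde u_0)+\nabla\cdot(\tilde b\tilde u_0)=\nabla\cdot F\ \text{ in }Y,\qquad \tilde u_0\ \text{is $Y$-periodic},\qquad \int_Y\tilde u_0=0,$$ in the very weak sense, that is, $\int_Y\tilde u_0=0$ and $\int_Y\tilde u_0(\tilde A:D^2\varphi+\tilde b\cdot\nabla\varphi)=\int_YF\cdot\nabla\varphi$ for all $\varphi\in H^2_{\mathrm{per}}(Y)$; moreover $\tilde u_0=-\nabla\cdot\tilde\rho_0$. Let $P_h$ be any closed linear subspace of $H^1_{\mathrm{per},0}(Y;\mathbb R^n)$. Then there is a unique $\tilde\rho_h\in P_h$ such that $B_2(\tilde\rho_h,w_h)=-\int_YF\cdot w_h$ for all $w_h\in P_h$, and $\tilde u_h:=-\nabla\cdot\tilde\rho_h\in L^2_{\mathrm{per}}(Y)$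 satisfies $$\|\tilde u_0-\tilde u_h\|_{L^2(Y)}\le C\inf_{w_h\in P_h}\|D(\tilde\rho_0-w_h)\|_{L^2(Y;\mathbb R^{n\times n})}$$ for some constant $C>0$ depending only on $\lambda,\Lambda,\delta,n$. -/

import Mathlib

open MeasureTheory
open scoped ContDiff

noncomputable section

namespace FPK

/-- Vectors in `ℝⁿ` with the Euclidean norm. -/
abbrev Vec (n : ℕ) := EuclideanSpace ℝ (Fin n)

/-- Real `n × n` matrices as a Euclidean space, i.e. with the Frobenius norm and inner product. -/
abbrev Mat (n : ℕ) := EuclideanSpace ℝ (Fin n × Fin n)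

/-- The unit cell `Y = (0,1)ⁿ`. -/
def Y (n : ℕ) : Set (Fin n → ℝ) := Set.univ.pi fun _ => Set.Ioo 0 1

/-- Lebesgue measure on the unit cell. -/
def μY (n : ℕ) : Measure (Fin n → ℝ) := volume.restrict (Y n)

/-- `L²_per(Y; E)`: a `Y`-periodic function is identified with its restriction to the cell `Y`
(every element of `L²(Y; E)` has a unique `Y`-periodic extension to `ℝⁿ`). -/
abbrev L2per (n : ℕ) (E : Type) [NormedAddCommGroup E] := Lp E 2 (μY n)

/-- Smooth `Y`-periodic functions on `ℝⁿ`. -/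
structure IsTest {n : ℕ} (φ : (Fin n → ℝ) → ℝ) : Prop where
  smooth : ContDiff ℝ ∞ φ
  periodic : ∀ (k : Fin n → ℤ) (x : Fin n → ℝ), φ (fun i => x i + (k i : ℝ)) = φ x

/-- The classical partial derivative `∂_j φ`. -/
def partialDeriv {n : ℕ} (j : Fin n) (φ : (Fin n → ℝ) → ℝ) (x : Fin n → ℝ) : ℝ :=
  fderiv ℝ φ x (Pi.single j 1)

/-- `v = ∂_j u` weakly, in the sense of periodic distributions: the test functions are
all smooth `Y`-periodic functions, so that no jumps of `u` across `∂Y` are allowed. -/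
def HasWeakPartial {n : ℕ} (j : Fin n) (u v : (Fin n → ℝ) → ℝ) : Prop :=
  ∀ φ : (Fin n → ℝ) → ℝ, IsTest φ →
    ∫ x, u x * partialDeriv j φ x ∂(μY n) = -∫ x, v x * φ x ∂(μY n)

/-- `g = ∇φ` weakly, for scalar `φ`. -/
def HasWeakGrad {n : ℕ} (φ : L2per n ℝ) (g : L2per n (Vec n)) : Prop :=
  ∀ j, HasWeakPartial j (fun x => φ x) (fun x => g x j)

/-- `G = Dw` weakly, for vector-valued `w`: `G_{ij} = ∂_j w_i`. -/
def HasWeakJac {n : ℕ} (w : L2per n (Vec n)) (G : L2per n (Mat n)) : Prop :=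
  ∀ i j, HasWeakPartial j (fun x => w x i) (fun x => G x (i, j))

section helpers

variable {n : ℕ}

instance instFiniteμY : IsFiniteMeasure (μY n) := by
  refine ⟨?_⟩
  rw [μY, Measure.restrict_apply_univ]
  refine lt_of_le_of_lt (measure_mono (t := Set.Icc (0 : Fin n → ℝ) 1) ?_)
    isCompact_Icc.measure_lt_top
  intro x hx
  exact ⟨fun i => (hx i trivial).1.le, fun i => (hx i trivial).2.le⟩

theorem memLp_of_continuous {f : (Fin n → ℝ) → ℝ} (hf : Continuous f) : MemLp f 2 (μY n) := by
  obtain ⟨C, hC⟩ := (isCompact_Icc (a := (0 : Fin n → ℝ)) (b := 1)).exists_bound_of_continuousOn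
    hf.continuousOn
  refine MemLp.of_bound hf.aestronglyMeasurable C ?_
  have hY : MeasurableSet (Y n) := MeasurableSet.univ_pi fun _ => measurableSet_Ioo
  rw [μY]
  filter_upwards [ae_restrict_mem hY] with x hx
  exact hC x ⟨fun i => (hx i trivial).1.le, fun i => (hx i trivial).2.le⟩

theorem IsTest.continuous_partialDeriv {φ : (Fin n → ℝ) → ℝ} (h : IsTest φ) (j : Fin n) :
    Continuous (partialDeriv j φ) :=
  (h.smooth.continuous_fderiv (by simp)).clm_apply continuous_const

theorem memLp_coord {ι : Type} [Fintype ι] (w : L2per n (EuclideanSpace ℝ ι)) (i : ι) :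
    MemLp (fun x => w x i) 2 (μY n) :=
  (EuclideanSpace.proj (𝕜 := ℝ) i).comp_memLp' (Lp.memLp w)

theorem HasWeakPartial.congr {j : Fin n} {u u' v v' : (Fin n → ℝ) → ℝ}
    (h : HasWeakPartial j u v) (hu : u' =ᵐ[μY n] u) (hv : v' =ᵐ[μY n] v) :
    HasWeakPartial j u' v' := by
  intro φ hφ
  have h1 : ∫ x, u' x * partialDeriv j φ x ∂(μY n) = ∫ x, u x * partialDeriv j φ x ∂(μY n) :=
    integral_congr_ae (by filter_upwards [hu] with x hx; rw [hx])
  have h2 : ∫ x, v' x * φ x ∂(μY n) = ∫ x, v x * φ x ∂(μY n) :=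
    integral_congr_ae (by filter_upwards [hv] with x hx; rw [hx])
  rw [h1, h2, h φ hφ]

theorem HasWeakPartial.add {j : Fin n} {u u' v v' : (Fin n → ℝ) → ℝ}
    (h : HasWeakPartial j u v) (h' : HasWeakPartial j u' v')
    (hu : MemLp u 2 (μY n)) (hu' : MemLp u' 2 (μY n))
    (hv : MemLp v 2 (μY n)) (hv' : MemLp v' 2 (μY n)) :
    HasWeakPartial j (fun x => u x + u' x) (fun x => v x + v' x) := by
  intro φ hφ
  have hd := memLp_of_continuous (hφ.continuous_partialDeriv j)
  have hc := memLp_of_continuous hφ.smooth.continuous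
  have h1 : ∫ x, (u x + u' x) * partialDeriv j φ x ∂(μY n) =
      (∫ x, u x * partialDeriv j φ x ∂(μY n)) + ∫ x, u' x * partialDeriv j φ x ∂(μY n) := by
    simp only [add_mul]
    exact integral_add (hu.integrable_mul hd) (hu'.integrable_mul hd)
  have h2 : ∫ x, (v x + v' x) * φ x ∂(μY n) =
      (∫ x, v x * φ x ∂(μY n)) + ∫ x, v' x * φ x ∂(μY n) := by
    simp only [add_mul]
    exact integral_add (hv.integrable_mul hc) (hv'.integrable_mul hc)
  rw [h1, h2, h φ hφ, h' φ hφ]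
  ring

theorem HasWeakPartial.const_mul {j : Fin n} {u v : (Fin n → ℝ) → ℝ} (c : ℝ)
    (h : HasWeakPartial j u v) :
    HasWeakPartial j (fun x => c * u x) (fun x => c * v x) := by
  intro φ hφ
  simp only [mul_assoc]
  rw [integral_const_mul, integral_const_mul, h φ hφ]
  ring

end helpers

/-- `H¹_{per,0}(Y; ℝⁿ)`: the mean-zero `w ∈ L²_per(Y; ℝⁿ)` with a weak Jacobian in
`L²_per(Y; ℝ^{n×n})`. A function is stored together with its (unique) weak Jacobian, as the pair
`(w, Dw)`, so that the norm inherited from `L² × L²` is the `H¹(Y)`-norm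
`(‖w‖² + ‖Dw‖²)^{1/2}`. -/
def H1per0 (n : ℕ) : Submodule ℝ (WithLp 2 (L2per n (Vec n) × L2per n (Mat n))) where
  carrier := {p | HasWeakJac p.fst p.snd ∧ ∫ x, p.fst x ∂(μY n) = 0}
  add_mem' := by
    rintro p q ⟨hp, hp0⟩ ⟨hq, hq0⟩
    refine ⟨fun i j => ?_, ?_⟩
    · refine ((hp i j).add (hq i j) (memLp_coord _ _) (memLp_coord _ _)
        (memLp_coord _ _) (memLp_coord _ _)).congr ?_ ?_
      · filter_upwards [Lp.coeFn_add p.fst q.fst] with x hx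
        rw [WithLp.add_fst, hx]
        rfl
      · filter_upwards [Lp.coeFn_add p.snd q.snd] with x hx
        rw [WithLp.add_snd, hx]
        rfl
    · rw [WithLp.add_fst, integral_congr_ae (Lp.coeFn_add p.fst q.fst)]
      simp only [Pi.add_apply]
      rw [integral_add ((Lp.memLp p.fst).integrable (by norm_num))
        ((Lp.memLp q.fst).integrable (by norm_num)), hp0, hq0, add_zero]
  zero_mem' := by
    refine ⟨fun i j => ?_, ?_⟩
    · have h0 : HasWeakPartial j (fun _ : Fin n → ℝ => (0 : ℝ)) (fun _ => 0) := by
        intro φ _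
        simp
      refine h0.congr ?_ ?_
      · filter_upwards [Lp.coeFn_zero (Vec n) 2 (μY n)] with x hx
        rw [WithLp.zero_fst, hx]
        rfl
      · filter_upwards [Lp.coeFn_zero (Mat n) 2 (μY n)] with x hx
        rw [WithLp.zero_snd, hx]
        rfl
    · rw [WithLp.zero_fst, integral_congr_ae (Lp.coeFn_zero (Vec n) 2 (μY n))]
      simp
  smul_mem' := by
    rintro c p ⟨hp, hp0⟩
    refine ⟨fun i j => ?_, ?_⟩
    · refine ((hp i j).const_mul c).congr ?_ ?_
      · filter_upwards [Lp.coeFn_smul c p.fst] with x hx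
        rw [WithLp.smul_fst, hx]
        rfl
      · filter_upwards [Lp.coeFn_smul c p.snd] with x hx
        rw [WithLp.smul_snd, hx]
        rfl
    · rw [WithLp.smul_fst, integral_congr_ae (Lp.coeFn_smul c p.fst)]
      simp only [Pi.smul_apply]
      rw [integral_smul, hp0, smul_zero]

/-- The underlying function of `w ∈ H¹_{per,0}(Y; ℝⁿ)`. -/
def fn {n : ℕ} (w : H1per0 n) : L2per n (Vec n) := w.1.fst

/-- The weak Jacobian `Dw`. -/
def D {n : ℕ} (w : H1per0 n) : L2per n (Mat n) := w.1.snd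

/-- The trace of a matrix. -/
def trL (n : ℕ) : Mat n →L[ℝ] ℝ := ∑ i : Fin n, EuclideanSpace.proj (i, i)

/-- The divergence `∇·w ∈ L²_per(Y)`, the trace of `Dw`. -/
def div {n : ℕ} (w : H1per0 n) : L2per n ℝ := (trL n).compLp (D w)

/-- The Frobenius product `M : N = ∑ M_{ij} N_{ij}`. -/
def frob {n : ℕ} (M N : Matrix (Fin n) (Fin n) ℝ) : ℝ := ∑ i, ∑ j, M i j * N i j

/-- An element of `Mat n` as a matrix. -/
def toMatrix {n : ℕ} (G : Mat n) : Matrix (Fin n) (Fin n) ℝ := Matrix.of fun i j => G (i, j)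

/-- `f ∈ L^∞_per(Y)`, as an essentially bounded function on `ℝⁿ` that is `Y`-periodic. -/
def IsLinftyPer {n : ℕ} (f : (Fin n → ℝ) → ℝ) : Prop :=
  MemLp f ⊤ volume ∧ ∀ k : Fin n → ℤ, ∀ᵐ x : Fin n → ℝ, f (fun i => x i + (k i : ℝ)) = f x

/-- The Cordes-type setting `ℬ`, with ellipticity constants `lam`, `Lam` and Cordes
parameter `δ`. -/
structure SettingB {n : ℕ} (lam Lam δ : ℝ) (A : (Fin n → ℝ) → Matrix (Fin n) (Fin n) ℝ)
    (b : (Fin n → ℝ) → Vec n) : Prop where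
  linfty_A : ∀ i j, IsLinftyPer fun x => A x i j
  linfty_b : ∀ i, IsLinftyPer fun x => b x i
  symm : ∀ᵐ x, (A x).IsSymm
  lam_pos : 0 < lam
  Lam_pos : 0 < Lam
  elliptic : ∀ᵐ x, ∀ ξ : Fin n → ℝ,
    lam * (ξ ⬝ᵥ ξ) ≤ ξ ⬝ᵥ (A x).mulVec ξ ∧ ξ ⬝ᵥ (A x).mulVec ξ ≤ Lam * (ξ ⬝ᵥ ξ)
  lt_δ : (n : ℝ) / (n + Real.pi ^ 2) < δ
  δ_le : δ ≤ 1
  cordes : ∀ᵐ x, (frob (A x) (A x) + ‖b x‖ ^ 2) / (A x).trace ^ 2 ≤ 1 / ((n : ℝ) - 1 + δ)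

section operators

variable {n : ℕ} (A : (Fin n → ℝ) → Matrix (Fin n) (Fin n) ℝ) (b : (Fin n → ℝ) → Vec n)

/-- The renormalization function `γ = tr(A) / (|A|² + |b|²)`. -/
def gam (x : Fin n → ℝ) : ℝ := (A x).trace / (frob (A x) (A x) + ‖b x‖ ^ 2)

/-- `Ã = γA`. -/
def Atil (x : Fin n → ℝ) : Matrix (Fin n) (Fin n) ℝ := gam A b x • A x

/-- `b̃ = γb`. -/
def btil (x : Fin n → ℝ) : Vec n := gam A b x • b x

/-- `Ã : G + b̃ · g` -/
def renOp (g : L2per n (Vec n)) (G : L2per n (Mat n)) (x : Fin n → ℝ) : ℝ :=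
  frob (Atil A b x) (toMatrix (G x)) + inner ℝ (btil A b x) (g x)

/-- The bilinear form
`B₂(v,w) = ∫_Y (∇·v)(Ã:Dw + b̃·w) + ½ ∫_Y (Dv - (Dv)ᵀ) : (Dw - (Dw)ᵀ)`. -/
def B2 (v w : H1per0 n) : ℝ :=
  (∫ x, div v x * renOp A b (fn w) (D w) x ∂(μY n)) +
    (1 / 2) * ∫ x, frob (toMatrix (D v x) - (toMatrix (D v x)).transpose)
      (toMatrix (D w x) - (toMatrix (D w x)).transpose) ∂(μY n)

/-- `ρ ∈ P` and `B₂(ρ,w) = -∫_Y F·w` for all `w ∈ P`. -/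
def IsVarSol (F : L2per n (Vec n)) (P : Submodule ℝ (H1per0 n)) (ρ : H1per0 n) : Prop :=
  ρ ∈ P ∧ ∀ w ∈ P, B2 A b ρ w = -∫ x, inner ℝ (F x) (fn w x) ∂(μY n)

/-- `u ∈ L²_per(Y)` is a very weak solution of `-D²:(Ãu) + ∇·(b̃u) = ∇·F`, `∫_Y u = 0`:
`∫_Y u (Ã:D²φ + b̃·∇φ) = ∫_Y F·∇φ` for all `φ ∈ H²_per(Y)`. Here `g = ∇φ` and `H = D²φ`. -/
def IsVeryWeakSol (F : L2per n (Vec n)) (u : L2per n ℝ) : Prop :=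
  (∀ (φ : L2per n ℝ) (g : L2per n (Vec n)) (H : L2per n (Mat n)),
    HasWeakGrad φ g → HasWeakJac g H →
      ∫ x, u x * renOp A b g H x ∂(μY n) = ∫ x, inner ℝ (F x) (g x) ∂(μY n)) ∧
  ∫ x, u x ∂(μY n) = 0

end operators

end FPK

end

/-!
By the Cordes condition, `Ã:Dw + b̃·w` differs from `∇·w` by an operator whose norm, relative to
`‖Dw‖`, is some `κ < 1`: completing the square turns the condition into
`|Ã - I|² + |b̃|² ≤ 1 - δ`, and Poincaré's inequality absorbs the lower-order term. Commuting weak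
derivatives on the Fourier side gives `∫ Dv:(Dw)ᵀ = ∫ (∇·v)(∇·w)`, so that
`B₂(v, w) = ∫ Dv:Dw + ∫ (∇·v)(Ã:Dw + b̃·w - ∇·w)`. Since `‖∇·v‖ ≤ ‖Dv‖`, this form is coercive with
constant `1 - κ` and bounded with constant `1 + κ` for the seminorm `‖D·‖`, and the theorems of
Lax-Milgram and Céa apply. On gradients `‖D∇φ‖ = ‖Δφ‖`, so a difference `u` of two very weak
solutions satisfies `|∫ u Δφ| ≤ κ ‖u‖ ‖Δφ‖`; the Laplacians being dense in the functions of mean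
zero, `‖u‖² ≤ κ ‖u‖²`.
-/

namespace FPK

open scoped ComplexConjugate

noncomputable section

section SquareIntegrable

variable {α ι : Type*} {mα : MeasurableSpace α} {μ : Measure α}

theorem inner_Lp_real (u v : Lp ℝ 2 μ) : inner ℝ u v = ∫ x, u x * v x ∂μ := by
  simp only [L2.inner_def, RCLike.inner_apply, conj_trivial, mul_comm]

variable [Fintype ι]

/-- The `i`-th coordinate of a square-integrable vector field, again as an `L²` class. -/
def coordLp (μ : Measure α) (i : ι) : Lp (EuclideanSpace ℝ ι) 2 μ →L[ℝ] Lp ℝ 2 μ :=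
  (EuclideanSpace.proj i).compLpL 2 μ

theorem coeFn_coordLp (i : ι) (f : Lp (EuclideanSpace ℝ ι) 2 μ) :
    coordLp μ i f =ᵐ[μ] fun x => f x i :=
  ContinuousLinearMap.coeFn_compLpL _ _

theorem inner_eq_sum_coordLp (f g : Lp (EuclideanSpace ℝ ι) 2 μ) :
    inner ℝ f g = ∑ i, inner ℝ (coordLp μ i f) (coordLp μ i g) := by
  simp only [L2.inner_def (𝕜 := ℝ)]
  rw [← integral_finsetSum _ fun i _ => L2.integrable_inner _ _]
  refine integral_congr_ae ?_
  filter_upwards [ae_all_iff.mpr fun i => coeFn_coordLp i f,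
    ae_all_iff.mpr fun i => coeFn_coordLp i g] with x hf hg
  simp only [PiLp.inner_apply, hf, hg]

theorem norm_sq_eq_sum_coordLp (f : Lp (EuclideanSpace ℝ ι) 2 μ) :
    ‖f‖ ^ 2 = ∑ i, ‖coordLp μ i f‖ ^ 2 := by
  simp only [← real_inner_self_eq_norm_sq, inner_eq_sum_coordLp f]

theorem exists_coordLp_eq (f : ι → Lp ℝ 2 μ) :
    ∃ g : Lp (EuclideanSpace ℝ ι) 2 μ, ∀ i, coordLp μ i g = f i := by
  have hmem : MemLp (fun x => (WithLp.toLp 2 fun i => f i x : EuclideanSpace ℝ ι)) 2 μ :=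
    MemLp.of_eval_piLp fun i => Lp.memLp (f i)
  refine ⟨hmem.toLp, fun i => Lp.ext ?_⟩
  filter_upwards [coeFn_coordLp i hmem.toLp, hmem.coeFn_toLp] with x hcoord hx
  rw [hcoord, hx]

end SquareIntegrable

section TestFunctions

variable {n : ℕ}

theorem IsTest.continuous {φ : (Fin n → ℝ) → ℝ} (hφ : IsTest φ) : Continuous φ :=
  hφ.smooth.continuous

theorem IsTest.differentiable {φ : (Fin n → ℝ) → ℝ} (hφ : IsTest φ) : Differentiable ℝ φ :=
  hφ.smooth.differentiable (by simp)

theorem IsTest.mul {φ ψ : (Fin n → ℝ) → ℝ} (hφ : IsTest φ) (hψ : IsTest ψ) :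
    IsTest fun x => φ x * ψ x :=
  ⟨hφ.smooth.mul hψ.smooth, fun k x => by simp only [hφ.periodic k x, hψ.periodic k x]⟩

theorem isTest_const (c : ℝ) : IsTest fun _ : Fin n → ℝ => c :=
  ⟨contDiff_const, fun _ _ => rfl⟩

theorem partialDeriv_const (j : Fin n) (c : ℝ) :
    partialDeriv j (fun _ : Fin n → ℝ => c) = fun _ => 0 := by
  ext x
  simp [partialDeriv]

theorem IsTest.partialDeriv_mul {φ ψ : (Fin n → ℝ) → ℝ} (hφ : IsTest φ) (hψ : IsTest ψ)
    (j : Fin n) (x : Fin n → ℝ) :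
    partialDeriv j (fun x => φ x * ψ x) x =
      φ x * partialDeriv j ψ x + partialDeriv j φ x * ψ x := by
  rw [partialDeriv, fderiv_fun_mul (hφ.differentiable x) (hψ.differentiable x)]
  simp [partialDeriv, mul_comm]

theorem IsTest.isTest_partialDeriv {φ : (Fin n → ℝ) → ℝ} (hφ : IsTest φ) (j : Fin n) :
    IsTest (partialDeriv j φ) := by
  refine ⟨(hφ.smooth.fderiv_right (m := ∞) (by simp)).clm_apply contDiff_const, fun k x => ?_⟩
  have hshift : (fun y : Fin n → ℝ => φ (y + fun i => (k i : ℝ))) = φ :=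
    funext fun y => hφ.periodic k y
  have hderiv := fderiv_comp_add_right (𝕜 := ℝ) (f := φ) (x := x) fun i => (k i : ℝ)
  rw [hshift] at hderiv
  exact congrArg (fun L : (Fin n → ℝ) →L[ℝ] ℝ => L (Pi.single j 1)) hderiv.symm

theorem Y_ae_eq_Icc : Y n =ᵐ[volume] Set.Icc 0 1 := by
  rw [volume_pi]
  exact Measure.univ_pi_Ioo_ae_eq_Icc (μ := fun _ : Fin n => (volume : Measure ℝ))

theorem IsTest.apply_insertNth_one {m : ℕ} {φ : (Fin (m + 1) → ℝ) → ℝ} (hφ : IsTest φ)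
    (j : Fin (m + 1)) (y : Fin m → ℝ) : φ (j.insertNth 1 y) = φ (j.insertNth 0 y) := by
  rw [← hφ.periodic (Pi.single j 1) (j.insertNth 0 y)]
  congr 1
  ext l
  refine Fin.succAboveCases j ?_ (fun l => ?_) l <;> simp

theorem IsTest.integral_partialDeriv {φ : (Fin n → ℝ) → ℝ} (hφ : IsTest φ) (j : Fin n) :
    ∫ x, partialDeriv j φ x ∂(μY n) = 0 := by
  obtain _ | m := n
  · exact j.elim0
  let S : ℝ →L[ℝ] Fin (m + 1) → ℝ := .single ℝ (fun _ => ℝ) j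
  have hdiv (x : Fin (m + 1) → ℝ) :
      ∑ i, S.comp (fderiv ℝ φ x) (Pi.single i 1) i = partialDeriv j φ x := by
    rw [Finset.sum_eq_single j (fun i _ hi => by simp [S, hi]) (by simp)]
    simp [S, partialDeriv]
  have hgauss := integral_divergence_of_hasFDerivAt_off_countable 0 (1 : Fin (m + 1) → ℝ)
    zero_le_one (fun x => S (φ x)) (fun x => S.comp (fderiv ℝ φ x)) ∅ Set.countable_empty
    (S.continuous.comp hφ.continuous).continuousOn
    (fun x _ => S.hasFDerivAt.comp x (hφ.differentiable x).hasFDerivAt)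
    (by simpa only [hdiv] using (hφ.continuous_partialDeriv j).integrableOn_Icc)
  rw [μY, Measure.restrict_congr_set Y_ae_eq_Icc]
  simp only [hdiv] at hgauss
  rw [hgauss]
  refine Finset.sum_eq_zero fun i _ => sub_eq_zero.mpr ?_
  obtain rfl | hi := eq_or_ne i j
  · simp only [Pi.one_apply, Pi.zero_apply, hφ.apply_insertNth_one]
  · simp [S, hi]

/-- The class of a continuous function in `L²_per(Y)`. -/
def ofContinuous {φ : (Fin n → ℝ) → ℝ} (hφ : Continuous φ) : L2per n ℝ :=
  (memLp_of_continuous hφ).toLp φ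

theorem coeFn_ofContinuous {φ : (Fin n → ℝ) → ℝ} (hφ : Continuous φ) :
    ofContinuous hφ =ᵐ[μY n] φ :=
  MemLp.coeFn_toLp _

theorem inner_ofContinuous (u : L2per n ℝ) {φ : (Fin n → ℝ) → ℝ} (hφ : Continuous φ) :
    inner ℝ u (ofContinuous hφ) = ∫ x, u x * φ x ∂(μY n) := by
  rw [inner_Lp_real]
  refine integral_congr_ae ?_
  filter_upwards [coeFn_ofContinuous hφ] with x hx
  rw [hx]

end TestFunctions

section WeakDerivatives

variable {n : ℕ}

theorem HasWeakPartial.integral_eq_zero {j : Fin n} {u v : (Fin n → ℝ) → ℝ}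
    (h : HasWeakPartial j u v) : ∫ x, v x ∂(μY n) = 0 := by
  simpa [partialDeriv_const] using h _ (isTest_const 1)

theorem IsTest.hasWeakPartial {φ : (Fin n → ℝ) → ℝ} (hφ : IsTest φ) (j : Fin n) :
    HasWeakPartial j φ (partialDeriv j φ) := by
  intro ψ hψ
  have hint (f g : (Fin n → ℝ) → ℝ) (hf : Continuous f) (hg : Continuous g) :
      Integrable (fun x => f x * g x) (μY n) :=
    (memLp_of_continuous hf).integrable_mul (memLp_of_continuous hg)
  have hparts := (hφ.mul hψ).integral_partialDeriv j
  simp only [hφ.partialDeriv_mul hψ] at hparts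
  rw [integral_add (hint _ _ hφ.continuous (hψ.continuous_partialDeriv j))
    (hint _ _ (hφ.continuous_partialDeriv j) hψ.continuous)] at hparts
  exact eq_neg_of_add_eq_zero_left hparts

theorem hasWeakPartial_iff_inner {j : Fin n} {u v : L2per n ℝ} :
    HasWeakPartial j u v ↔ ∀ (φ : (Fin n → ℝ) → ℝ) (hφ : IsTest φ),
      inner ℝ u (ofContinuous (hφ.continuous_partialDeriv j)) =
        -inner ℝ v (ofContinuous hφ.continuous) := by
  simp only [HasWeakPartial, inner_ofContinuous]

/-- The graph of the weak derivative `∂_j` in `L²_per(Y)`. -/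
def weakPartialGraph (j : Fin n) : Submodule ℝ (L2per n ℝ × L2per n ℝ) where
  carrier := {p | HasWeakPartial j p.1 p.2}
  add_mem' {p q} hp hq := by
    simp only [Set.mem_ofPred_eq, hasWeakPartial_iff_inner] at hp hq ⊢
    intro φ hφ
    rw [Prod.fst_add, Prod.snd_add, inner_add_left, inner_add_left, hp φ hφ, hq φ hφ, neg_add]
  zero_mem' := by
    simp [hasWeakPartial_iff_inner]
  smul_mem' c p hp := by
    simp only [Set.mem_ofPred_eq, hasWeakPartial_iff_inner] at hp ⊢
    intro φ hφ
    rw [Prod.smul_fst, Prod.smul_snd, real_inner_smul_left, real_inner_smul_left, hp φ hφ,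
      mul_neg]

theorem mem_weakPartialGraph {j : Fin n} {u v : L2per n ℝ} :
    (u, v) ∈ weakPartialGraph j ↔ HasWeakPartial j u v :=
  Iff.rfl

theorem isClosed_weakPartialGraph (j : Fin n) :
    IsClosed (weakPartialGraph j : Set (L2per n ℝ × L2per n ℝ)) := by
  have hgraph : (weakPartialGraph j : Set (L2per n ℝ × L2per n ℝ)) =
      ⋂ (φ : (Fin n → ℝ) → ℝ) (hφ : IsTest φ),
        {p | inner ℝ p.1 (ofContinuous (hφ.continuous_partialDeriv j)) =
          -inner ℝ p.2 (ofContinuous hφ.continuous)} := by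
    ext ⟨u, v⟩
    simp only [SetLike.mem_coe, mem_weakPartialGraph, hasWeakPartial_iff_inner, Set.mem_iInter,
      Set.mem_ofPred_eq]
  rw [hgraph]
  exact isClosed_iInter fun φ => isClosed_iInter fun hφ => isClosed_eq
    (continuous_fst.inner continuous_const) (continuous_snd.inner continuous_const).neg

theorem hasWeakGrad_iff {φ : L2per n ℝ} {g : L2per n (Vec n)} :
    HasWeakGrad φ g ↔ ∀ j, (φ, coordLp (μY n) j g) ∈ weakPartialGraph j :=
  forall_congr' fun j =>
    ⟨fun h => h.congr .rfl (coeFn_coordLp j g), fun h => h.congr .rfl (coeFn_coordLp j g).symm⟩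

theorem hasWeakJac_iff {w : L2per n (Vec n)} {G : L2per n (Mat n)} :
    HasWeakJac w G ↔
      ∀ i j, (coordLp (μY n) i w, coordLp (μY n) (i, j) G) ∈ weakPartialGraph j :=
  forall₂_congr fun i j =>
    ⟨fun h => h.congr (coeFn_coordLp i w) (coeFn_coordLp (i, j) G),
      fun h => h.congr (coeFn_coordLp i w).symm (coeFn_coordLp (i, j) G).symm⟩

end WeakDerivatives

section FourierModes

variable {n : ℕ}

/-- The phase `2π k·x`, as a continuous linear form in `x`. -/
def phase (k : Fin n → ℤ) : (Fin n → ℝ) →L[ℝ] ℝ :=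
  ∑ i, (2 * Real.pi * k i) • ContinuousLinearMap.proj (R := ℝ) i

theorem phase_apply (k : Fin n → ℤ) (x : Fin n → ℝ) :
    phase k x = 2 * Real.pi * ∑ i, k i * x i := by
  simp [phase, Finset.mul_sum, mul_assoc]

theorem phase_single (k : Fin n → ℤ) (j : Fin n) :
    phase k (Pi.single j 1) = 2 * Real.pi * k j := by
  simp [phase_apply, Pi.single_apply]

theorem phase_neg (k : Fin n → ℤ) (x : Fin n → ℝ) : phase (-k) x = -phase k x := by
  simp [phase_apply]

theorem phase_add_int (k l : Fin n → ℤ) (x : Fin n → ℝ) :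
    phase k (fun i => x i + (l i : ℝ)) = phase k x + (∑ i, k i * l i : ℤ) * (2 * Real.pi) := by
  simp only [phase_apply, mul_add, Finset.sum_add_distrib]
  push_cast
  ring

theorem isTest_cos_phase (k : Fin n → ℤ) : IsTest fun x => Real.cos (phase k x) :=
  ⟨Real.contDiff_cos.comp (phase k).contDiff, fun l x => by
    rw [phase_add_int, Real.cos_add_int_mul_two_pi]⟩

theorem isTest_sin_phase (k : Fin n → ℤ) : IsTest fun x => Real.sin (phase k x) :=
  ⟨Real.contDiff_sin.comp (phase k).contDiff, fun l x => by
    rw [phase_add_int, Real.sin_add_int_mul_two_pi]⟩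

theorem partialDeriv_cos_phase (k : Fin n → ℤ) (j : Fin n) :
    partialDeriv j (fun x => Real.cos (phase k x)) =
      -(2 * Real.pi * k j) • fun x => Real.sin (phase k x) := by
  ext x
  rw [partialDeriv, ((phase k).hasFDerivAt.cos (x := x)).fderiv]
  simp [phase_single, mul_comm]

theorem partialDeriv_sin_phase (k : Fin n → ℤ) (j : Fin n) :
    partialDeriv j (fun x => Real.sin (phase k x)) =
      (2 * Real.pi * k j) • fun x => Real.cos (phase k x) := by
  ext x
  rw [partialDeriv, ((phase k).hasFDerivAt.sin (x := x)).fderiv]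
  simp [phase_single, mul_comm]

theorem partialDeriv_const_smul (j : Fin n) (c : ℝ) (φ : (Fin n → ℝ) → ℝ) :
    partialDeriv j (c • φ) = c • partialDeriv j φ := by
  ext x
  simp [partialDeriv, fderiv_const_smul_field]

theorem partialDeriv_partialDeriv_cos_phase (k : Fin n → ℤ) (j : Fin n) :
    partialDeriv j (partialDeriv j fun x => Real.cos (phase k x)) =
      -(2 * Real.pi * k j) ^ 2 • fun x => Real.cos (phase k x) := by
  rw [partialDeriv_cos_phase, partialDeriv_const_smul, partialDeriv_sin_phase, smul_smul,
    neg_mul, ← sq]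

theorem partialDeriv_partialDeriv_sin_phase (k : Fin n → ℤ) (j : Fin n) :
    partialDeriv j (partialDeriv j fun x => Real.sin (phase k x)) =
      -(2 * Real.pi * k j) ^ 2 • fun x => Real.sin (phase k x) := by
  rw [partialDeriv_sin_phase, partialDeriv_const_smul, partialDeriv_cos_phase, smul_smul,
    mul_neg, ← sq]

end FourierModes

section Torus

variable {n : ℕ}

/-- The normalized Haar measure on the torus. -/
def torusMeasure (n : ℕ) : Measure (UnitAddTorus (Fin n)) :=
  Measure.pi fun _ => AddCircle.haarAddCircle

/-- The cell `(0,1]ⁿ`, written with the endpoints `0` and `0 + 1` of the fundamental domain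
in `UnitAddTorus.measurableEquivPiIoc`. -/
def halfOpenCell (n : ℕ) : Set (Fin n → ℝ) :=
  {x | ∀ i, x i ∈ Set.Ioc ((0 : Fin n → ℝ) i) ((0 : Fin n → ℝ) i + 1)}

theorem measurableSet_halfOpenCell : MeasurableSet (halfOpenCell n) :=
  MeasurableSet.univ_pi' fun _ => measurableSet_Ioc

theorem Y_ae_eq_halfOpenCell : Y n =ᵐ[volume] halfOpenCell n := by
  have hcell : halfOpenCell n = Set.univ.pi fun _ => Set.Ioc 0 1 := by
    ext x
    simp [halfOpenCell]
  rw [hcell, volume_pi]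
  exact Measure.univ_pi_Ioo_ae_eq_Icc.trans Measure.univ_pi_Ioc_ae_eq_Icc.symm

/-- The section of the covering `ℝⁿ → ℝⁿ/ℤⁿ` with values in `(0,1]ⁿ`. -/
def torusSection (t : UnitAddTorus (Fin n)) : Fin n → ℝ :=
  (UnitAddTorus.measurableEquivPiIoc (0 : Fin n → ℝ) t).1

theorem coe_torusSection (t : UnitAddTorus (Fin n)) (i : Fin n) :
    ((torusSection t i : ℝ) : UnitAddCircle) = t i :=
  (AddCircle.equivIoc 1 0).symm_apply_apply (t i)

theorem measurableEmbedding_torusSection :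
    MeasurableEmbedding (torusSection : UnitAddTorus (Fin n) → Fin n → ℝ) :=
  (MeasurableEmbedding.subtype_coe measurableSet_halfOpenCell).comp
    (UnitAddTorus.measurableEquivPiIoc (0 : Fin n → ℝ)).measurableEmbedding

theorem measurePreserving_torusSection :
    MeasurePreserving (torusSection : UnitAddTorus (Fin n) → Fin n → ℝ)
      (torusMeasure n) (μY n) := by
  have hcell : MeasurePreserving (Subtype.val : halfOpenCell n → Fin n → ℝ)
      (Measure.comap Subtype.val volume) (μY n) := by
    refine ⟨measurable_subtype_coe, ?_⟩
    rw [μY, Measure.restrict_congr_set Y_ae_eq_halfOpenCell]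
    exact map_comap_subtype_coe measurableSet_halfOpenCell _
  exact hcell.comp (UnitAddTorus.measurePreserving_equivPiIoc (0 : Fin n → ℝ))

theorem mFourier_eq_exp_phase (k : Fin n → ℤ) (t : UnitAddTorus (Fin n)) :
    UnitAddTorus.mFourier k t = Complex.exp (phase k (torusSection t) * Complex.I) := by
  have hphase : (phase k (torusSection t) * Complex.I : ℂ) =
      ∑ i, 2 * Real.pi * Complex.I * k i * torusSection t i / (1 : ℝ) := by
    rw [phase_apply]
    push_cast
    rw [Finset.mul_sum, Finset.sum_mul]
    exact Finset.sum_congr rfl fun i _ => by ring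
  rw [hphase, Complex.exp_sum]
  change ∏ i, fourier (k i) (t i) = _
  refine Finset.prod_congr rfl fun i _ => ?_
  rw [← coe_torusSection t i, fourier_coe_apply]

/-- An element of `L²_per(Y)` as a complex square-integrable function on the torus. -/
def toTorus (u : L2per n ℝ) : Lp ℂ 2 (torusMeasure n) :=
  Complex.ofRealCLM.compLp (Lp.compMeasurePreserving torusSection measurePreserving_torusSection u)

theorem coeFn_toTorus (u : L2per n ℝ) :
    toTorus u =ᵐ[torusMeasure n] fun t => (u (torusSection t) : ℂ) := by
  filter_upwards [Complex.ofRealCLM.coeFn_compLp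
      (Lp.compMeasurePreserving torusSection measurePreserving_torusSection u),
    Lp.coeFn_compMeasurePreserving u measurePreserving_torusSection] with t ht hu
  rw [toTorus, ht, hu]
  rfl

theorem integral_conj_toTorus_mul (u v : L2per n ℝ) :
    ∫ t, conj (toTorus u t) * toTorus v t ∂(torusMeasure n) = (inner ℝ u v : ℝ) := by
  rw [inner_Lp_real, ← integral_complex_ofReal,
    ← measurePreserving_torusSection.integral_comp measurableEmbedding_torusSection]
  refine integral_congr_ae ?_
  filter_upwards [coeFn_toTorus u, coeFn_toTorus v] with t hu hv
  rw [hu, hv, Complex.conj_ofReal, Complex.ofReal_mul]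

end Torus

section FourierCoefficients

variable {n : ℕ}

/-- The Fourier coefficient `∫_Y u(x) exp(-2πi k·x) dx`. -/
def fourierCoeff (u : L2per n ℝ) (k : Fin n → ℤ) : ℂ :=
  UnitAddTorus.mFourierCoeff (toTorus u) k

theorem hasSum_conj_fourierCoeff_mul (u v : L2per n ℝ) :
    HasSum (fun k => conj (fourierCoeff u k) * fourierCoeff v k) (inner ℝ u v : ℝ) := by
  rw [← integral_conj_toTorus_mul]
  exact UnitAddTorus.hasSum_prod_mFourierCoeff (toTorus u) (toTorus v)

theorem hasSum_norm_sq_fourierCoeff (u : L2per n ℝ) :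
    HasSum (fun k => ‖fourierCoeff u k‖ ^ 2) (‖u‖ ^ 2) := by
  rw [← Complex.hasSum_ofReal, ← real_inner_self_eq_norm_sq]
  simpa only [Complex.conj_mul', Complex.ofReal_pow] using hasSum_conj_fourierCoeff_mul u u

theorem fourierCoeff_eq_inner (u : L2per n ℝ) (k : Fin n → ℤ) :
    fourierCoeff u k = (inner ℝ u (ofContinuous (isTest_cos_phase k).continuous) : ℝ) -
      (inner ℝ u (ofContinuous (isTest_sin_phase k).continuous) : ℝ) * Complex.I := by
  have hcoeff : fourierCoeff u k = ∫ x, ((u x * Real.cos (phase k x) : ℝ) : ℂ) -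
      ((u x * Real.sin (phase k x) : ℝ) : ℂ) * Complex.I ∂(μY n) := by
    rw [← measurePreserving_torusSection.integral_comp measurableEmbedding_torusSection]
    refine integral_congr_ae ?_
    filter_upwards [coeFn_toTorus u] with t ht
    rw [ht, smul_eq_mul, mFourier_eq_exp_phase, Complex.exp_mul_I, ← Complex.ofReal_cos,
      ← Complex.ofReal_sin, phase_neg, Real.cos_neg, Real.sin_neg]
    push_cast
    ring
  have hint (φ : (Fin n → ℝ) → ℝ) (hφ : Continuous φ) :
      Integrable (fun x => ((u x * φ x : ℝ) : ℂ)) (μY n) :=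
    ((Lp.memLp u).integrable_mul (memLp_of_continuous hφ)).ofReal
  rw [hcoeff, integral_sub (hint _ (isTest_cos_phase k).continuous)
    ((hint _ (isTest_sin_phase k).continuous).mul_const _), integral_mul_const,
    integral_complex_ofReal, integral_complex_ofReal, inner_ofContinuous, inner_ofContinuous]

theorem fourierCoeff_zero_right (u : L2per n ℝ) : fourierCoeff u 0 = (∫ x, u x ∂(μY n) : ℝ) := by
  simp [fourierCoeff_eq_inner, inner_ofContinuous, phase_apply]

theorem fourierCoeff_injective : Function.Injective (fourierCoeff (n := n)) := by
  intro u v huv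
  have hzero (k : Fin n → ℤ) : fourierCoeff (u - v) k = 0 := by
    have hk := congrFun huv k
    simp only [fourierCoeff_eq_inner, inner_sub_left, Complex.ofReal_sub] at hk ⊢
    linear_combination hk
  have hsum := hasSum_norm_sq_fourierCoeff (u - v)
  simp only [hzero, norm_zero, ne_eq, OfNat.ofNat_ne_zero, not_false_eq_true, zero_pow] at hsum
  simpa [sub_eq_zero] using hsum.unique hasSum_zero

theorem inner_ofContinuous_smul (u : L2per n ℝ) (c : ℝ) {φ ψ : (Fin n → ℝ) → ℝ}
    (hφ : Continuous φ) (hψ : Continuous ψ) (h : ψ = c • φ) :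
    inner ℝ u (ofContinuous hψ) = c * inner ℝ u (ofContinuous hφ) := by
  subst h
  simp only [inner_ofContinuous, ← integral_const_mul, Pi.smul_apply, smul_eq_mul, mul_left_comm]

theorem HasWeakPartial.fourierCoeff {j : Fin n} {u v : L2per n ℝ} (h : HasWeakPartial j u v)
    (k : Fin n → ℤ) :
    fourierCoeff v k = (2 * Real.pi * k j : ℝ) * Complex.I * fourierCoeff u k := by
  have hcos := hasWeakPartial_iff_inner.mp h _ (isTest_cos_phase k)
  have hsin := hasWeakPartial_iff_inner.mp h _ (isTest_sin_phase k)
  rw [inner_ofContinuous_smul u _ (isTest_sin_phase k).continuous _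
    (partialDeriv_cos_phase k j)] at hcos
  rw [inner_ofContinuous_smul u _ (isTest_cos_phase k).continuous _
    (partialDeriv_sin_phase k j)] at hsin
  rw [fourierCoeff_eq_inner, fourierCoeff_eq_inner, ← neg_eq_iff_eq_neg.mpr hcos,
    ← neg_eq_iff_eq_neg.mpr hsin]
  push_cast
  ring_nf
  simp only [Complex.I_sq]
  ring

theorem one_le_sum_sq_of_ne_zero {k : Fin n → ℤ} (hk : k ≠ 0) :
    (1 : ℝ) ≤ ∑ j, (k j : ℝ) ^ 2 := by
  obtain ⟨j, hj⟩ := Function.ne_iff.mp hk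
  have hone : (1 : ℝ) ≤ (k j : ℝ) ^ 2 := by
    exact_mod_cast Order.one_le_iff_pos.mpr (sq_pos_of_ne_zero hj)
  exact hone.trans (Finset.single_le_sum (f := fun j => (k j : ℝ) ^ 2)
    (fun i _ => sq_nonneg _) (Finset.mem_univ j))

theorem inner_weakPartial_comm {j l : Fin n} {a aj al b bj bl : L2per n ℝ}
    (haj : HasWeakPartial j a aj) (hal : HasWeakPartial l a al)
    (hbj : HasWeakPartial j b bj) (hbl : HasWeakPartial l b bl) :
    inner ℝ aj bl = inner ℝ al bj := by
  have hcoeff (k : Fin n → ℤ) : conj (FPK.fourierCoeff aj k) * FPK.fourierCoeff bl k =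
      conj (FPK.fourierCoeff al k) * FPK.fourierCoeff bj k := by
    rw [haj.fourierCoeff, hal.fourierCoeff, hbj.fourierCoeff, hbl.fourierCoeff]
    simp only [map_mul, Complex.conj_ofReal]
    push_cast
    ring
  have hsum := hasSum_conj_fourierCoeff_mul aj bl
  simp only [hcoeff] at hsum
  exact_mod_cast hsum.unique (hasSum_conj_fourierCoeff_mul al bj)

theorem weakPartial_weakPartial_comm {i j : Fin n} {φ gi gj hij hji : L2per n ℝ}
    (hgi : HasWeakPartial i φ gi) (hgj : HasWeakPartial j φ gj)
    (hhij : HasWeakPartial j gi hij) (hhji : HasWeakPartial i gj hji) : hij = hji := by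
  refine fourierCoeff_injective (funext fun k => ?_)
  rw [hhij.fourierCoeff, hhji.fourierCoeff, hgi.fourierCoeff, hgj.fourierCoeff]
  ring

theorem poincare {u : L2per n ℝ} {g : Fin n → L2per n ℝ} (hg : ∀ j, HasWeakPartial j u (g j))
    (hmean : ∫ x, u x ∂(μY n) = 0) :
    (2 * Real.pi) ^ 2 * ‖u‖ ^ 2 ≤ ∑ j, ‖g j‖ ^ 2 := by
  refine hasSum_le (fun k => ?_) ((hasSum_norm_sq_fourierCoeff u).mul_left _)
    (hasSum_sum fun j _ => hasSum_norm_sq_fourierCoeff (g j))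
  have hcoeff (j : Fin n) : ‖fourierCoeff (g j) k‖ ^ 2 =
      (2 * Real.pi) ^ 2 * ‖fourierCoeff u k‖ ^ 2 * (k j : ℝ) ^ 2 := by
    rw [(hg j).fourierCoeff, norm_mul, norm_mul, Complex.norm_I, Complex.norm_real,
      Real.norm_eq_abs, mul_one, mul_pow, sq_abs]
    ring
  simp only [hcoeff, ← Finset.mul_sum]
  obtain rfl | hk := eq_or_ne k 0
  · simp [fourierCoeff_zero_right, hmean]
  · exact le_mul_of_one_le_right (by positivity) (one_le_sum_sq_of_ne_zero hk)

end FourierCoefficients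

section PeriodicSobolev

variable {n : ℕ}

theorem integral_coordLp {ι : Type} [Fintype ι] (i : ι) (f : L2per n (EuclideanSpace ℝ ι)) :
    ∫ x, coordLp (μY n) i f x ∂(μY n) = (∫ x, f x ∂(μY n)) i := by
  rw [integral_congr_ae (coeFn_coordLp i f)]
  exact (EuclideanSpace.proj i).integral_comp_comm ((Lp.memLp f).integrable (by norm_num))

theorem integral_eq_zero_iff_coordLp {ι : Type} [Fintype ι] {f : L2per n (EuclideanSpace ℝ ι)} :
    ∫ x, f x ∂(μY n) = 0 ↔ ∀ i, ∫ x, coordLp (μY n) i f x ∂(μY n) = 0 := by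
  simp only [integral_coordLp]
  exact PiLp.ext_iff

theorem integral_eq_inner_one (u : L2per n ℝ) :
    ∫ x, u x ∂(μY n) = inner ℝ u (ofContinuous (continuous_const (y := (1 : ℝ)))) := by
  simp [inner_ofContinuous]

theorem isClosed_H1per0 :
    IsClosed (H1per0 n : Set (WithLp 2 (L2per n (Vec n) × L2per n (Mat n)))) := by
  have hset : (H1per0 n : Set (WithLp 2 (L2per n (Vec n) × L2per n (Mat n)))) =
      (⋂ i, ⋂ j, (fun p => (coordLp (μY n) i (WithLp.fstL 2 ℝ _ _ p),
        coordLp (μY n) (i, j) (WithLp.sndL 2 ℝ _ _ p))) ⁻¹' weakPartialGraph j) ∩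
      ⋂ i, {p | inner ℝ (coordLp (μY n) i (WithLp.fstL 2 ℝ _ _ p))
        (ofContinuous (continuous_const (y := (1 : ℝ)))) = 0} := by
    ext p
    simp only [← integral_eq_inner_one, Set.mem_inter_iff, Set.mem_iInter, Set.mem_preimage,
      Set.mem_ofPred_eq]
    exact and_congr hasWeakJac_iff integral_eq_zero_iff_coordLp
  rw [hset]
  exact (isClosed_iInter fun i => isClosed_iInter fun j =>
    (isClosed_weakPartialGraph j).preimage (by fun_prop)).inter
    (isClosed_iInter fun i => isClosed_eq (Continuous.inner (by fun_prop) continuous_const)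
      continuous_const)

instance instCompleteSpaceH1per0 : CompleteSpace (H1per0 n) :=
  isClosed_H1per0.completeSpace_coe

/-- `fn` as a bounded operator. -/
def fnL (n : ℕ) : H1per0 n →L[ℝ] L2per n (Vec n) :=
  (WithLp.fstL 2 ℝ _ _).comp (H1per0 n).subtypeL

/-- `D` as a bounded operator. -/
def DL (n : ℕ) : H1per0 n →L[ℝ] L2per n (Mat n) :=
  (WithLp.sndL 2 ℝ _ _).comp (H1per0 n).subtypeL

/-- `div` as a bounded operator. -/
def divL (n : ℕ) : H1per0 n →L[ℝ] L2per n ℝ :=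
  ((trL n).compLpL 2 (μY n)).comp (DL n)

theorem fnL_apply (w : H1per0 n) : fnL n w = fn w := rfl

theorem norm_sq_H1per0 (w : H1per0 n) : ‖w‖ ^ 2 = ‖fn w‖ ^ 2 + ‖D w‖ ^ 2 :=
  WithLp.prod_norm_sq_eq_of_L2 w.1

theorem hasWeakPartial_coordLp (w : H1per0 n) (i j : Fin n) :
    HasWeakPartial j (coordLp (μY n) i (fn w)) (coordLp (μY n) (i, j) (D w)) :=
  hasWeakJac_iff.mp w.2.1 i j

theorem trL_apply (M : Mat n) : trL n M = ∑ i, M (i, i) := by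
  simp [trL]

theorem coeFn_div (w : H1per0 n) : div w =ᵐ[μY n] fun x => trL n (D w x) :=
  ContinuousLinearMap.coeFn_compLp _ _

theorem div_eq_sum_coordLp (w : H1per0 n) : div w = ∑ i, coordLp (μY n) (i, i) (D w) := by
  refine Lp.ext ?_
  filter_upwards [coeFn_div w,
    Lp.coeFn_finsetSum Finset.univ fun i => coordLp (μY n) (i, i) (D w),
    ae_all_iff.mpr fun p => coeFn_coordLp p (D w)] with x hdiv hsum hcoord
  simp only [hdiv, hsum, trL_apply, Finset.sum_apply, hcoord]

theorem integral_div (w : H1per0 n) : ∫ x, div w x ∂(μY n) = 0 := by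
  rw [integral_eq_inner_one, div_eq_sum_coordLp, sum_inner]
  exact Finset.sum_eq_zero fun i _ => by
    rw [← integral_eq_inner_one, (hasWeakPartial_coordLp w i i).integral_eq_zero]

theorem inner_div_div (v w : H1per0 n) :
    inner ℝ (div v) (div w) =
      ∑ i, ∑ j, inner ℝ (coordLp (μY n) (i, j) (D v)) (coordLp (μY n) (j, i) (D w)) := by
  rw [div_eq_sum_coordLp, div_eq_sum_coordLp, sum_inner]
  refine Finset.sum_congr rfl fun i _ => ?_
  rw [inner_sum]
  exact Finset.sum_congr rfl fun j _ =>
    inner_weakPartial_comm (hasWeakPartial_coordLp v i i) (hasWeakPartial_coordLp v i j)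
      (hasWeakPartial_coordLp w j i) (hasWeakPartial_coordLp w j j)

theorem frob_sub_transpose (M N : Matrix (Fin n) (Fin n) ℝ) :
    frob (M - M.transpose) (N - N.transpose) = 2 * (frob M N - frob M N.transpose) := by
  have hswap : frob M.transpose N = frob M N.transpose := Finset.sum_comm
  have hswap' : frob M.transpose N.transpose = frob M N := Finset.sum_comm
  have hexpand : frob (M - M.transpose) (N - N.transpose) =
      frob M N - frob M N.transpose - (frob M.transpose N - frob M.transpose N.transpose) := by
    simp only [frob, ← Finset.sum_sub_distrib, Matrix.sub_apply]
    exact Finset.sum_congr rfl fun i _ => Finset.sum_congr rfl fun j _ => by ring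
  rw [hexpand, hswap, hswap']
  ring

theorem inner_mat_eq_frob (M N : Mat n) : inner ℝ M N = frob (toMatrix M) (toMatrix N) := by
  simp only [PiLp.inner_apply, RCLike.inner_apply, conj_trivial, Fintype.sum_prod_type, frob,
    toMatrix, Matrix.of_apply, mul_comm]

theorem half_integral_frob_sub_transpose (G H : L2per n (Mat n)) :
    (1 / 2) * ∫ x, frob (toMatrix (G x) - (toMatrix (G x)).transpose)
      (toMatrix (H x) - (toMatrix (H x)).transpose) ∂(μY n) =
    inner ℝ G H - ∑ i, ∑ j, inner ℝ (coordLp (μY n) (i, j) G) (coordLp (μY n) (j, i) H) := by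
  have hint (p q : Fin n × Fin n) : Integrable (fun x => G x p * H x q) (μY n) :=
    (memLp_coord G p).integrable_mul (memLp_coord H q)
  have hcoord (p q : Fin n × Fin n) :
      inner ℝ (coordLp (μY n) p G) (coordLp (μY n) q H) = ∫ x, G x p * H x q ∂(μY n) := by
    rw [inner_Lp_real]
    refine integral_congr_ae ?_
    filter_upwards [coeFn_coordLp p G, coeFn_coordLp q H] with x hG hH
    rw [hG, hH]
  have htranspose : ∫ x, frob (toMatrix (G x)) (toMatrix (H x)).transpose ∂(μY n) =
      ∑ i, ∑ j, inner ℝ (coordLp (μY n) (i, j) G) (coordLp (μY n) (j, i) H) := by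
    simp only [hcoord]
    rw [← Fintype.sum_prod_type' fun i j => ∫ x, G x (i, j) * H x (j, i) ∂(μY n),
      ← integral_finsetSum _ fun p _ => hint p (p.2, p.1)]
    simp only [frob, toMatrix, Matrix.transpose_apply, Matrix.of_apply, Fintype.sum_prod_type]
  have hint_transpose :
      Integrable (fun x => frob (toMatrix (G x)) (toMatrix (H x)).transpose) (μY n) :=
    integrable_finsetSum _ fun i _ => integrable_finsetSum _ fun j _ => hint (i, j) (j, i)
  simp only [frob_sub_transpose, ← inner_mat_eq_frob]
  rw [integral_const_mul, integral_sub (L2.integrable_inner G H) hint_transpose, htranspose,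
    ← L2.inner_def]
  ring

theorem half_integral_skew (v w : H1per0 n) :
    (1 / 2) * ∫ x, frob (toMatrix (D v x) - (toMatrix (D v x)).transpose)
      (toMatrix (D w x) - (toMatrix (D w x)).transpose) ∂(μY n) =
    inner ℝ (D v) (D w) - inner ℝ (div v) (div w) := by
  rw [half_integral_frob_sub_transpose, inner_div_div]

theorem norm_div_le (w : H1per0 n) : ‖div w‖ ≤ ‖D w‖ := by
  have hskew := half_integral_skew w w
  have hnonneg : 0 ≤ ∫ x, frob (toMatrix (D w x) - (toMatrix (D w x)).transpose)
      (toMatrix (D w x) - (toMatrix (D w x)).transpose) ∂(μY n) :=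
    integral_nonneg fun x => Finset.sum_nonneg fun i _ => Finset.sum_nonneg fun j _ =>
      mul_self_nonneg _
  rw [real_inner_self_eq_norm_sq, real_inner_self_eq_norm_sq] at hskew
  exact le_of_sq_le_sq (by linarith) (norm_nonneg _)

theorem norm_fn_sq_le (w : H1per0 n) : (2 * Real.pi) ^ 2 * ‖fn w‖ ^ 2 ≤ ‖D w‖ ^ 2 := by
  rw [norm_sq_eq_sum_coordLp, norm_sq_eq_sum_coordLp, Fintype.sum_prod_type, Finset.mul_sum]
  exact Finset.sum_le_sum fun i _ => poincare (hasWeakPartial_coordLp w i)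
    (integral_eq_zero_iff_coordLp.mp w.2.2 i)

theorem norm_sq_le_mul_norm_D_sq (w : H1per0 n) :
    ‖w‖ ^ 2 ≤ (1 + 1 / (2 * Real.pi) ^ 2) * ‖D w‖ ^ 2 := by
  have hfn : ‖fn w‖ ^ 2 ≤ 1 / (2 * Real.pi) ^ 2 * ‖D w‖ ^ 2 := by
    rw [one_div_mul_eq_div, le_div_iff₀' (by positivity)]
    exact norm_fn_sq_le w
  rw [norm_sq_H1per0, one_add_mul]
  linarith

end PeriodicSobolev

section Gradients

variable {n : ℕ}

/-- The gradients `∇φ` of functions `φ ∈ H²_per(Y)`. -/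
def gradients (n : ℕ) : Submodule ℝ (H1per0 n) where
  carrier := {w | ∃ φ, HasWeakGrad φ (fn w)}
  add_mem' := by
    rintro v w ⟨φ, hφ⟩ ⟨ψ, hψ⟩
    rw [hasWeakGrad_iff] at hφ hψ
    refine ⟨φ + ψ, hasWeakGrad_iff.mpr fun j => ?_⟩
    rw [← fnL_apply, map_add, map_add]
    exact add_mem (hφ j) (hψ j)
  zero_mem' := ⟨0, hasWeakGrad_iff.mpr fun j => by
    rw [← fnL_apply, map_zero, map_zero]
    exact zero_mem (weakPartialGraph j)⟩
  smul_mem' := by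
    rintro c w ⟨φ, hφ⟩
    rw [hasWeakGrad_iff] at hφ
    refine ⟨c • φ, hasWeakGrad_iff.mpr fun j => ?_⟩
    rw [← fnL_apply, map_smul, map_smul]
    exact (weakPartialGraph j).smul_mem c (hφ j)

theorem exists_mem_gradients {φ : L2per n ℝ} {g : L2per n (Vec n)} {H : L2per n (Mat n)}
    (hg : HasWeakGrad φ g) (hH : HasWeakJac g H) : ∃ w ∈ gradients n, fn w = g ∧ D w = H := by
  have hmean : ∫ x, g x ∂(μY n) = 0 := integral_eq_zero_iff_coordLp.mpr fun j =>
    (mem_weakPartialGraph.mp (hasWeakGrad_iff.mp hg j)).integral_eq_zero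
  exact ⟨⟨WithLp.toLp 2 (g, H), hH, hmean⟩, ⟨φ, hg⟩, rfl, rfl⟩

theorem coordLp_D_comm {w : H1per0 n} (hw : w ∈ gradients n) (i j : Fin n) :
    coordLp (μY n) (i, j) (D w) = coordLp (μY n) (j, i) (D w) := by
  obtain ⟨φ, hφ⟩ := hw
  rw [hasWeakGrad_iff] at hφ
  exact weakPartial_weakPartial_comm (hφ i) (hφ j) (hasWeakPartial_coordLp w i j)
    (hasWeakPartial_coordLp w j i)

theorem inner_D_D_of_mem_gradients (v : H1per0 n) {w : H1per0 n} (hw : w ∈ gradients n) :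
    inner ℝ (D v) (D w) = inner ℝ (div v) (div w) := by
  rw [inner_div_div, inner_eq_sum_coordLp, Fintype.sum_prod_type]
  simp only [coordLp_D_comm hw]

theorem norm_D_of_mem_gradients {w : H1per0 n} (hw : w ∈ gradients n) : ‖D w‖ = ‖div w‖ := by
  rw [← sq_eq_sq₀ (norm_nonneg _) (norm_nonneg _), ← real_inner_self_eq_norm_sq,
    ← real_inner_self_eq_norm_sq, inner_D_D_of_mem_gradients w hw]

theorem IsTest.ofContinuous_mem_weakPartialGraph {ψ : (Fin n → ℝ) → ℝ} (hψ : IsTest ψ)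
    (j : Fin n) : (ofContinuous hψ.continuous, ofContinuous (hψ.continuous_partialDeriv j)) ∈
      weakPartialGraph j :=
  (hψ.hasWeakPartial j).congr (coeFn_ofContinuous hψ.continuous)
    (coeFn_ofContinuous (hψ.continuous_partialDeriv j))

theorem IsTest.exists_mem_gradients_div_eq {ψ : (Fin n → ℝ) → ℝ} (hψ : IsTest ψ) :
    ∃ w ∈ gradients n, div w =
      ∑ i, ofContinuous ((hψ.isTest_partialDeriv i).continuous_partialDeriv i) := by
  obtain ⟨g, hg⟩ := exists_coordLp_eq fun j => ofContinuous (hψ.continuous_partialDeriv j)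
  obtain ⟨H, hH⟩ := exists_coordLp_eq fun p : Fin n × Fin n =>
    ofContinuous ((hψ.isTest_partialDeriv p.1).continuous_partialDeriv p.2)
  have hgrad : HasWeakGrad (ofContinuous hψ.continuous) g := hasWeakGrad_iff.mpr fun j => by
    rw [hg]
    exact hψ.ofContinuous_mem_weakPartialGraph j
  have hjac : HasWeakJac g H := hasWeakJac_iff.mpr fun i j => by
    rw [hg, hH]
    exact (hψ.isTest_partialDeriv i).ofContinuous_mem_weakPartialGraph j
  obtain ⟨w, hw, -, rfl⟩ := exists_mem_gradients hgrad hjac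
  exact ⟨w, hw, by simp only [div_eq_sum_coordLp, hH]⟩

theorem inner_eq_zero_of_forall_gradients {f : L2per n ℝ}
    (hf : ∀ w ∈ gradients n, inner ℝ f (div w) = 0) {k : Fin n → ℤ} (hk : k ≠ 0)
    {ψ : (Fin n → ℝ) → ℝ} (hψ : IsTest ψ)
    (heigen : ∀ j, partialDeriv j (partialDeriv j ψ) = -(2 * Real.pi * k j) ^ 2 • ψ) :
    inner ℝ f (ofContinuous hψ.continuous) = 0 := by
  obtain ⟨w, hw, hdiv⟩ := hψ.exists_mem_gradients_div_eq
  have horth := hf w hw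
  rw [hdiv, inner_sum] at horth
  simp only [inner_ofContinuous_smul f _ hψ.continuous _ (heigen _), neg_mul,
    Finset.sum_neg_distrib, neg_eq_zero, ← Finset.sum_mul] at horth
  have hfactor : 0 < ∑ j, (2 * Real.pi * k j) ^ 2 := by
    simp only [mul_pow _ (_ : ℝ), ← Finset.mul_sum]
    exact mul_pos (by positivity) (one_pos.trans_le (one_le_sum_sq_of_ne_zero hk))
  exact (mul_eq_zero.mp horth).resolve_left hfactor.ne'

theorem fourierCoeff_eq_zero_of_forall_gradients {f : L2per n ℝ}
    (hf : ∀ w ∈ gradients n, inner ℝ f (div w) = 0) {k : Fin n → ℤ} (hk : k ≠ 0) :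
    fourierCoeff f k = 0 := by
  simp [fourierCoeff_eq_inner,
    inner_eq_zero_of_forall_gradients hf hk (isTest_cos_phase k)
      (partialDeriv_partialDeriv_cos_phase k),
    inner_eq_zero_of_forall_gradients hf hk (isTest_sin_phase k)
      (partialDeriv_partialDeriv_sin_phase k)]

theorem mem_closure_map_divL_gradients {u : L2per n ℝ} (hu : ∫ x, u x ∂(μY n) = 0) :
    u ∈ ((gradients n).map (divL n).toLinearMap).topologicalClosure := by
  rw [← Submodule.orthogonal_orthogonal_eq_closure, Submodule.mem_orthogonal]
  intro f hf
  have hgrad (w : H1per0 n) (hw : w ∈ gradients n) : inner ℝ f (div w) = 0 :=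
    (Submodule.mem_orthogonal' _ f).mp hf _ (Submodule.mem_map_of_mem hw)
  have hterm (k : Fin n → ℤ) : conj (fourierCoeff f k) * fourierCoeff u k = 0 := by
    obtain rfl | hk := eq_or_ne k 0
    · simp [fourierCoeff_zero_right, hu]
    · simp [fourierCoeff_eq_zero_of_forall_gradients hgrad hk]
  have hsum := hasSum_conj_fourierCoeff_mul f u
  simp only [hterm] at hsum
  exact_mod_cast hsum.unique hasSum_zero

end Gradients

section Frobenius

variable {n : ℕ}

/-- A matrix as an element of the Frobenius space `Mat n`; the inverse of `toMatrix`. -/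
def ofMatrix (M : Matrix (Fin n) (Fin n) ℝ) : Mat n :=
  WithLp.toLp 2 fun p => M p.1 p.2

theorem frob_toMatrix_right (M : Matrix (Fin n) (Fin n) ℝ) (G : Mat n) :
    frob M (toMatrix G) = inner ℝ (ofMatrix M) G := by
  rw [inner_mat_eq_frob]
  rfl

theorem norm_sq_ofMatrix (M : Matrix (Fin n) (Fin n) ℝ) : ‖ofMatrix M‖ ^ 2 = frob M M := by
  rw [← real_inner_self_eq_norm_sq, inner_mat_eq_frob]
  rfl

theorem inner_ofMatrix_one (G : Mat n) : inner ℝ (ofMatrix 1) G = trL n G := by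
  simp [← frob_toMatrix_right, frob, Matrix.one_apply, toMatrix, trL_apply]

theorem ofMatrix_sub (M N : Matrix (Fin n) (Fin n) ℝ) :
    ofMatrix (M - N) = ofMatrix M - ofMatrix N := rfl

theorem ofMatrix_smul (c : ℝ) (M : Matrix (Fin n) (Fin n) ℝ) :
    ofMatrix (c • M) = c • ofMatrix M := rfl

theorem norm_sq_ofMatrix_smul_sub_one (c : ℝ) (M : Matrix (Fin n) (Fin n) ℝ) :
    ‖ofMatrix (c • M - 1)‖ ^ 2 = c ^ 2 * frob M M - 2 * c * M.trace + n := by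
  have htrace : inner ℝ (ofMatrix M) (ofMatrix 1) = M.trace := by
    rw [real_inner_comm, inner_ofMatrix_one, trL_apply]
    rfl
  have hone : ‖ofMatrix (1 : Matrix (Fin n) (Fin n) ℝ)‖ ^ 2 = n := by
    simp [norm_sq_ofMatrix, frob, Matrix.one_apply]
  rw [ofMatrix_sub, ofMatrix_smul, norm_sub_sq_real, hone, norm_smul, mul_pow, norm_sq_ofMatrix,
    real_inner_smul_left, htrace, Real.norm_eq_abs, sq_abs, mul_assoc]

theorem frob_self_pos_of_trace_ne_zero {M : Matrix (Fin n) (Fin n) ℝ} (hM : M.trace ≠ 0) :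
    0 < frob M M := by
  obtain ⟨i, -, hi⟩ := Finset.exists_ne_zero_of_sum_ne_zero hM
  exact Finset.sum_pos' (fun i _ => Finset.sum_nonneg fun j _ => mul_self_nonneg _)
    ⟨i, Finset.mem_univ i, Finset.sum_pos' (fun j _ => mul_self_nonneg _)
      ⟨i, Finset.mem_univ i, mul_self_pos.mpr hi⟩⟩

end Frobenius

section CordesCondition

variable {n : ℕ} {δ : ℝ} {A : (Fin n → ℝ) → Matrix (Fin n) (Fin n) ℝ} {b : (Fin n → ℝ) → Vec n}

/-- The Cordes condition with parameter `δ` on the cell `Y`, for measurable coefficients. The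
nonvanishing trace keeps the quotient in the condition, and hence `γ`, meaningful. -/
structure CordesCondition (δ : ℝ) (A : (Fin n → ℝ) → Matrix (Fin n) (Fin n) ℝ)
    (b : (Fin n → ℝ) → Vec n) : Prop where
  aemeasurable_A : ∀ i j, AEMeasurable (fun x => A x i j) (μY n)
  aemeasurable_b : ∀ i, AEMeasurable (fun x => b x i) (μY n)
  trace_ne_zero : ∀ᵐ x ∂(μY n), (A x).trace ≠ 0
  cordes : ∀ᵐ x ∂(μY n),
    (frob (A x) (A x) + ‖b x‖ ^ 2) / (A x).trace ^ 2 ≤ 1 / ((n : ℝ) - 1 + δ)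

theorem norm_sq_Atil_sub_one_add_norm_sq_btil {x : Fin n → ℝ} (htrace : (A x).trace ≠ 0) :
    ‖ofMatrix (Atil A b x - 1)‖ ^ 2 + ‖btil A b x‖ ^ 2 =
      n - (A x).trace ^ 2 / (frob (A x) (A x) + ‖b x‖ ^ 2) := by
  have hpos : 0 < frob (A x) (A x) + ‖b x‖ ^ 2 :=
    add_pos_of_pos_of_nonneg (frob_self_pos_of_trace_ne_zero htrace) (sq_nonneg _)
  rw [Atil, norm_sq_ofMatrix_smul_sub_one, btil, norm_smul, mul_pow, Real.norm_eq_abs, sq_abs,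
    gam]
  field_simp
  ring

theorem CordesCondition.norm_sq_add_norm_sq_le (h : CordesCondition δ A b) :
    ∀ᵐ x ∂(μY n), ‖ofMatrix (Atil A b x - 1)‖ ^ 2 + ‖btil A b x‖ ^ 2 ≤ 1 - δ := by
  filter_upwards [h.trace_ne_zero, h.cordes] with x htrace hcordes
  have hnum : 0 < frob (A x) (A x) + ‖b x‖ ^ 2 :=
    add_pos_of_pos_of_nonneg (frob_self_pos_of_trace_ne_zero htrace) (sq_nonneg _)
  have htrace_sq : 0 < (A x).trace ^ 2 := by positivity
  have hden : 0 < (n : ℝ) - 1 + δ := one_div_pos.mp ((div_pos hnum htrace_sq).trans_le hcordes)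
  have hquot : (n : ℝ) - 1 + δ ≤ (A x).trace ^ 2 / (frob (A x) (A x) + ‖b x‖ ^ 2) := by
    rw [← inv_div, ← one_div]
    exact (le_one_div (div_pos hnum htrace_sq) hden).mp hcordes
  rw [norm_sq_Atil_sub_one_add_norm_sq_btil htrace]
  linarith

theorem CordesCondition.aemeasurable_gam (h : CordesCondition δ A b) :
    AEMeasurable (gam A b) (μY n) := by
  have htrace : AEMeasurable (fun x => (A x).trace) (μY n) :=
    Finset.aemeasurable_fun_sum _ fun i _ => h.aemeasurable_A i i
  have hfrob : AEMeasurable (fun x => frob (A x) (A x)) (μY n) :=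
    Finset.aemeasurable_fun_sum _ fun i _ => Finset.aemeasurable_fun_sum _ fun j _ =>
      (h.aemeasurable_A i j).mul (h.aemeasurable_A i j)
  have hb : AEMeasurable (fun x => ‖b x‖ ^ 2) (μY n) := by
    simp only [EuclideanSpace.real_norm_sq_eq]
    exact Finset.aemeasurable_fun_sum _ fun i _ => (h.aemeasurable_b i).pow_const 2
  exact htrace.div (hfrob.add hb)

theorem CordesCondition.aestronglyMeasurable_Atil_sub_one (h : CordesCondition δ A b) :
    AEStronglyMeasurable (fun x => ofMatrix (Atil A b x - 1)) (μY n) :=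
  ((WithLp.measurable_toLp 2 _).comp_aemeasurable
    (f := fun x (p : Fin n × Fin n) => (Atil A b x - 1) p.1 p.2)
    (aemeasurable_pi_lambda _ fun p =>
      (h.aemeasurable_gam.mul (h.aemeasurable_A p.1 p.2)).sub_const _)).aestronglyMeasurable

theorem CordesCondition.aestronglyMeasurable_btil (h : CordesCondition δ A b) :
    AEStronglyMeasurable (btil A b) (μY n) :=
  (h.aemeasurable_gam.smul ((WithLp.measurable_toLp 2 _).comp_aemeasurable
    (f := fun x i => b x i) (aemeasurable_pi_lambda _ h.aemeasurable_b))).aestronglyMeasurable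

end CordesCondition

section Perturbation

variable {n : ℕ} {δ : ℝ} {A : (Fin n → ℝ) → Matrix (Fin n) (Fin n) ℝ} {b : (Fin n → ℝ) → Vec n}

/-- The difference `Ã:Dw + b̃·w - ∇·w` between the renormalized operator and the divergence. -/
def pert (A : (Fin n → ℝ) → Matrix (Fin n) (Fin n) ℝ) (b : (Fin n → ℝ) → Vec n) (w : H1per0 n)
    (x : Fin n → ℝ) : ℝ :=
  inner ℝ (ofMatrix (Atil A b x - 1)) (D w x) + inner ℝ (btil A b x) (fn w x)

theorem renOp_eq_add_pert (w : H1per0 n) (x : Fin n → ℝ) :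
    renOp A b (fn w) (D w) x = trL n (D w x) + pert A b w x := by
  rw [renOp, pert, frob_toMatrix_right, ofMatrix_sub, inner_sub_left, inner_ofMatrix_one]
  ring

theorem norm_sq_L2per {E : Type} [NormedAddCommGroup E] [InnerProductSpace ℝ E]
    (f : L2per n E) : ‖f‖ ^ 2 = ∫ x, ‖f x‖ ^ 2 ∂(μY n) := by
  simp only [← real_inner_self_eq_norm_sq, L2.inner_def]

theorem sq_inner_add_inner_le {E F : Type*} [NormedAddCommGroup E] [InnerProductSpace ℝ E]
    [NormedAddCommGroup F] [InnerProductSpace ℝ F] (a c : E) (b d : F) :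
    (inner ℝ a c + inner ℝ b d) ^ 2 ≤ (‖a‖ ^ 2 + ‖b‖ ^ 2) * (‖c‖ ^ 2 + ‖d‖ ^ 2) := by
  have hcauchy := real_inner_mul_inner_self_le (WithLp.toLp 2 (a, b)) (WithLp.toLp 2 (c, d))
  simpa only [WithLp.prod_inner_apply, real_inner_self_eq_norm_sq, ← sq] using hcauchy

theorem CordesCondition.pert_sq_le (h : CordesCondition δ A b) (w : H1per0 n) :
    ∀ᵐ x ∂(μY n), pert A b w x ^ 2 ≤ (1 - δ) * (‖D w x‖ ^ 2 + ‖fn w x‖ ^ 2) := by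
  filter_upwards [h.norm_sq_add_norm_sq_le] with x hx
  exact (sq_inner_add_inner_le _ _ _ _).trans (mul_le_mul_of_nonneg_right hx (by positivity))

theorem integrable_norm_sq_add_norm_sq (w : H1per0 n) :
    Integrable (fun x => ‖D w x‖ ^ 2 + ‖fn w x‖ ^ 2) (μY n) :=
  ((Lp.memLp (D w)).integrable_norm_pow (by norm_num)).add
    ((Lp.memLp (fn w)).integrable_norm_pow (by norm_num))

theorem CordesCondition.memLp_pert (h : CordesCondition δ A b) (w : H1per0 n) :
    MemLp (pert A b w) 2 (μY n) := by
  have hmeas : AEStronglyMeasurable (pert A b w) (μY n) :=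
    (h.aestronglyMeasurable_Atil_sub_one.inner (Lp.aestronglyMeasurable (D w))).add
      (h.aestronglyMeasurable_btil.inner (Lp.aestronglyMeasurable (fn w)))
  refine (memLp_two_iff_integrable_sq hmeas).mpr
    (((integrable_norm_sq_add_norm_sq w).const_mul (1 - δ)).mono' (hmeas.pow 2) ?_)
  filter_upwards [h.pert_sq_le w] with x hx
  rwa [Real.norm_of_nonneg (sq_nonneg _)]

theorem CordesCondition.norm_toLp_pert_le (h : CordesCondition δ A b) (w : H1per0 n) :
    ‖(h.memLp_pert w).toLp‖ ≤ √(1 - δ) * ‖w‖ := by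
  have hsq : ‖(h.memLp_pert w).toLp‖ ^ 2 ≤ (1 - δ) * ‖w‖ ^ 2 := calc
    _ = ∫ x, pert A b w x ^ 2 ∂(μY n) := by
      rw [norm_sq_L2per]
      refine integral_congr_ae ?_
      filter_upwards [(h.memLp_pert w).coeFn_toLp] with x hx
      rw [hx, Real.norm_eq_abs, sq_abs]
    _ ≤ ∫ x, (1 - δ) * (‖D w x‖ ^ 2 + ‖fn w x‖ ^ 2) ∂(μY n) :=
      integral_mono_ae (h.memLp_pert w).integrable_sq
        ((integrable_norm_sq_add_norm_sq w).const_mul _) (h.pert_sq_le w)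
    _ = (1 - δ) * ‖w‖ ^ 2 := by
      rw [integral_const_mul, integral_add ((Lp.memLp _).integrable_norm_pow (by norm_num))
        ((Lp.memLp _).integrable_norm_pow (by norm_num)), ← norm_sq_L2per, ← norm_sq_L2per,
        norm_sq_H1per0, add_comm]
  rw [← Real.sqrt_sq (norm_nonneg w), ← Real.sqrt_mul' _ (sq_nonneg ‖w‖)]
  exact Real.le_sqrt_of_sq_le hsq

/-- The perturbation `w ↦ Ã:Dw + b̃·w - ∇·w` as a bounded operator. -/
def CordesCondition.pertL (h : CordesCondition δ A b) : H1per0 n →L[ℝ] L2per n ℝ :=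
  LinearMap.mkContinuous
    { toFun := fun w => (h.memLp_pert w).toLp
      map_add' := fun v w => by
        rw [← MemLp.toLp_add, MemLp.toLp_eq_toLp_iff]
        filter_upwards [Lp.coeFn_add (fn v) (fn w), Lp.coeFn_add (D v) (D w)] with x hfn hD
        have hfn_add : fn (v + w) = fn v + fn w := map_add (fnL n) v w
        have hD_add : D (v + w) = D v + D w := map_add (DL n) v w
        simp only [pert, hfn_add, hD_add, hfn, hD, Pi.add_apply, inner_add_right]
        ring
      map_smul' := fun c w => by
        rw [RingHom.id_apply, ← MemLp.toLp_const_smul, MemLp.toLp_eq_toLp_iff]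
        filter_upwards [Lp.coeFn_smul c (fn w), Lp.coeFn_smul c (D w)] with x hfn hD
        have hfn_smul : fn (c • w) = c • fn w := map_smul (fnL n) c w
        have hD_smul : D (c • w) = c • D w := map_smul (DL n) c w
        simp only [pert, hfn_smul, hD_smul, hfn, hD, Pi.smul_apply, inner_smul_right,
          smul_eq_mul]
        ring }
    √(1 - δ) h.norm_toLp_pert_le

theorem CordesCondition.coeFn_pertL (h : CordesCondition δ A b) (w : H1per0 n) :
    h.pertL w =ᵐ[μY n] pert A b w :=
  (h.memLp_pert w).coeFn_toLp

theorem CordesCondition.integral_mul_renOp (h : CordesCondition δ A b) (u : L2per n ℝ)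
    (w : H1per0 n) :
    ∫ x, u x * renOp A b (fn w) (D w) x ∂(μY n) = inner ℝ u (div w + h.pertL w) := by
  rw [inner_Lp_real]
  refine integral_congr_ae ?_
  filter_upwards [Lp.coeFn_add (div w) (h.pertL w), coeFn_div w, h.coeFn_pertL w]
    with x hadd hdiv hpert
  rw [hadd, Pi.add_apply, hdiv, hpert, renOp_eq_add_pert]

/-- The relative size of the perturbation, as a bound for `‖Ã:Dw + b̃·w - ∇·w‖ / ‖Dw‖`. -/
def cordesConst (δ : ℝ) : ℝ := √(1 - δ) * √(1 + 1 / (2 * Real.pi) ^ 2)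

theorem cordesConst_nonneg (δ : ℝ) : 0 ≤ cordesConst δ := by
  unfold cordesConst
  positivity

theorem cordesConst_lt_one (hδ : 1 / (1 + (2 * Real.pi) ^ 2) < δ) : cordesConst δ < 1 := by
  have hpi : 0 < (2 * Real.pi) ^ 2 := by positivity
  rw [cordesConst, ← Real.sqrt_mul' _ (by positivity), Real.sqrt_lt' one_pos, one_pow,
    one_add_div hpi.ne', ← mul_div_assoc, div_lt_one hpi]
  rw [div_lt_iff₀ (by positivity)] at hδ
  linarith

theorem CordesCondition.norm_pertL_le (h : CordesCondition δ A b) (w : H1per0 n) :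
    ‖h.pertL w‖ ≤ cordesConst δ * ‖D w‖ := by
  have hw : ‖w‖ ≤ √(1 + 1 / (2 * Real.pi) ^ 2) * ‖D w‖ := by
    rw [← Real.sqrt_sq (norm_nonneg (D w)), ← Real.sqrt_mul' _ (sq_nonneg ‖D w‖)]
    exact Real.le_sqrt_of_sq_le (norm_sq_le_mul_norm_D_sq w)
  rw [cordesConst, mul_assoc]
  exact (h.norm_toLp_pert_le w).trans (mul_le_mul_of_nonneg_left hw (Real.sqrt_nonneg _))

end Perturbation

section CoerciveForms

variable {V : Type*} [NormedAddCommGroup V] [InnerProductSpace ℝ V]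

theorem existsUnique_of_isCoercive [CompleteSpace V] {B : V →L[ℝ] V →L[ℝ] ℝ}
    (hB : IsCoercive B) (l : V →L[ℝ] ℝ) : ∃! u, ∀ w, B u w = l w := by
  refine ⟨hB.continuousLinearEquivOfBilin.symm ((InnerProductSpace.toDual ℝ V).symm l),
    fun w => ?_, fun u hu => ?_⟩
  · rw [← hB.continuousLinearEquivOfBilin_apply, ContinuousLinearEquiv.apply_symm_apply,
      InnerProductSpace.toDual_symm_apply]
  · rw [ContinuousLinearEquiv.eq_symm_apply]
    refine ext_inner_right ℝ fun w => ?_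
    rw [hB.continuousLinearEquivOfBilin_apply, hu, InnerProductSpace.toDual_symm_apply]

theorem existsUnique_mem_of_isCoercive [CompleteSpace V] {B : V →L[ℝ] V →L[ℝ] ℝ}
    (hB : IsCoercive B) (l : V →L[ℝ] ℝ) {P : Submodule ℝ V} (hP : IsClosed (P : Set V)) :
    ∃! u, u ∈ P ∧ ∀ w ∈ P, B u w = l w := by
  have : CompleteSpace P := hP.completeSpace_coe
  obtain ⟨c, hc, hle⟩ := hB
  have hcoercive : IsCoercive (B.bilinearComp P.subtypeL P.subtypeL) :=
    ⟨c, hc, fun u => hle u⟩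
  obtain ⟨u, hu, hunique⟩ := existsUnique_of_isCoercive hcoercive (l.comp P.subtypeL)
  exact ⟨u, ⟨u.2, fun w hw => hu ⟨w, hw⟩⟩,
    fun v hv => congrArg Subtype.val (hunique ⟨v, hv.1⟩ fun w => hv.2 w w.2)⟩

end CoerciveForms

section Cea

variable {V : Type*} [AddCommGroup V] [Module ℝ V]

theorem cea_of_seminorm (p : Seminorm ℝ V) {B : V →ₗ[ℝ] V →ₗ[ℝ] ℝ} {α M : ℝ} (hα : 0 < α)
    (hcoercive : ∀ v, α * p v ^ 2 ≤ B v v) (hbounded : ∀ v w, |B v w| ≤ M * (p v * p w))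
    {P : Submodule ℝ V} {l : V → ℝ} {u uh w : V} (hu : ∀ v ∈ P, B u v = l v) (huh : uh ∈ P)
    (huh_eq : ∀ v ∈ P, B uh v = l v) (hw : w ∈ P) : p (u - uh) ≤ M / α * p (u - w) := by
  have horth : B (u - uh) (w - uh) = 0 := by
    have hmem := P.sub_mem hw huh
    rw [LinearMap.map_sub₂, hu _ hmem, huh_eq _ hmem, sub_self]
  have henergy : α * p (u - uh) ^ 2 ≤ M * (p (u - uh) * p (u - w)) := calc
    _ ≤ B (u - uh) (u - uh) := hcoercive _
    _ = B (u - uh) (u - w) := by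
      rw [← sub_add_sub_cancel u w uh, map_add (B _), sub_add_sub_cancel, horth, add_zero]
    _ ≤ _ := (le_abs_self _).trans (hbounded _ _)
  have hratio : 0 ≤ M / α * p (u - w) := by
    rcases (apply_nonneg p (u - w)).eq_or_lt with hzero | hpos
    · rw [← hzero, mul_zero]
    · have hM : 0 ≤ M := nonneg_of_mul_nonneg_left
        ((abs_nonneg _).trans (hbounded (u - w) (u - w))) (mul_pos hpos hpos)
      positivity
  rcases (apply_nonneg p (u - uh)).eq_or_lt with hzero | hpos
  · rwa [← hzero]
  · rw [div_mul_eq_mul_div, le_div_iff₀ hα]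
    exact le_of_mul_le_mul_left (by linarith) hpos

end Cea

section Form

variable {n : ℕ} {δ : ℝ} {A : (Fin n → ℝ) → Matrix (Fin n) (Fin n) ℝ} {b : (Fin n → ℝ) → Vec n}

/-- `B₂` as a bounded bilinear form, in the shape `∫ Dv:Dw + ∫ (∇·v)(Ã:Dw + b̃·w - ∇·w)` that
shows its coercivity. -/
def CordesCondition.formL (h : CordesCondition δ A b) : H1per0 n →L[ℝ] H1per0 n →L[ℝ] ℝ :=
  (innerSL ℝ).bilinearComp (DL n) (DL n) + (innerSL ℝ).bilinearComp (divL n) h.pertL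

theorem CordesCondition.formL_apply (h : CordesCondition δ A b) (v w : H1per0 n) :
    h.formL v w = inner ℝ (D v) (D w) + inner ℝ (div v) (h.pertL w) := rfl

theorem CordesCondition.B2_eq_formL (h : CordesCondition δ A b) (v w : H1per0 n) :
    B2 A b v w = h.formL v w := by
  rw [B2, h.integral_mul_renOp, half_integral_skew, inner_add_right, h.formL_apply]
  ring

theorem CordesCondition.abs_inner_pertL_le (h : CordesCondition δ A b) (u : L2per n ℝ)
    (w : H1per0 n) : |inner ℝ u (h.pertL w)| ≤ cordesConst δ * (‖u‖ * ‖D w‖) := calc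
  _ ≤ ‖u‖ * ‖h.pertL w‖ := abs_real_inner_le_norm _ _
  _ ≤ ‖u‖ * (cordesConst δ * ‖D w‖) := by gcongr; exact h.norm_pertL_le w
  _ = _ := mul_left_comm _ _ _

theorem CordesCondition.abs_inner_div_pertL_le (h : CordesCondition δ A b) (v w : H1per0 n) :
    |inner ℝ (div v) (h.pertL w)| ≤ cordesConst δ * (‖D v‖ * ‖D w‖) := by
  have hκ := cordesConst_nonneg δ
  refine (h.abs_inner_pertL_le (div v) w).trans ?_
  gcongr
  exact norm_div_le v

theorem CordesCondition.abs_formL_le (h : CordesCondition δ A b) (v w : H1per0 n) :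
    |h.formL v w| ≤ (1 + cordesConst δ) * (‖D v‖ * ‖D w‖) := by
  rw [h.formL_apply, add_mul, one_mul]
  exact (abs_add_le _ _).trans
    (add_le_add (abs_real_inner_le_norm _ _) (h.abs_inner_div_pertL_le v w))

theorem CordesCondition.le_formL_self (h : CordesCondition δ A b) (w : H1per0 n) :
    (1 - cordesConst δ) * ‖D w‖ ^ 2 ≤ h.formL w w := by
  have hpert := (abs_le.mp (h.abs_inner_div_pertL_le w w)).1
  rw [h.formL_apply, real_inner_self_eq_norm_sq]
  linarith

theorem cea_ratio_pos (hδ : 1 / (1 + (2 * Real.pi) ^ 2) < δ) :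
    0 < (1 + cordesConst δ) / (1 - cordesConst δ) :=
  div_pos (by linarith [cordesConst_nonneg δ]) (sub_pos.mpr (cordesConst_lt_one hδ))

theorem CordesCondition.isCoercive_formL (h : CordesCondition δ A b)
    (hδ : 1 / (1 + (2 * Real.pi) ^ 2) < δ) : IsCoercive h.formL := by
  have hκ := sub_pos.mpr (cordesConst_lt_one hδ)
  refine ⟨(1 - cordesConst δ) / (1 + 1 / (2 * Real.pi) ^ 2), by positivity, fun w => ?_⟩
  calc
    _ = (1 - cordesConst δ) * (‖w‖ ^ 2 / (1 + 1 / (2 * Real.pi) ^ 2)) := by ring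
    _ ≤ (1 - cordesConst δ) * ‖D w‖ ^ 2 := by
      gcongr
      exact (div_le_iff₀' (by positivity)).mpr (norm_sq_le_mul_norm_D_sq w)
    _ ≤ _ := h.le_formL_self w

/-- The functional `w ↦ -∫ F·w`. -/
def rhsL (F : L2per n (Vec n)) : H1per0 n →L[ℝ] ℝ := -(innerSL ℝ F).comp (fnL n)

theorem rhsL_apply (F : L2per n (Vec n)) (w : H1per0 n) : rhsL F w = -inner ℝ F (fn w) := rfl

theorem CordesCondition.isVarSol_iff (h : CordesCondition δ A b) {F : L2per n (Vec n)}
    {P : Submodule ℝ (H1per0 n)} {ρ : H1per0 n} :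
    IsVarSol A b F P ρ ↔ ρ ∈ P ∧ ∀ w ∈ P, h.formL ρ w = rhsL F w := by
  simp only [IsVarSol, h.B2_eq_formL, rhsL_apply, L2.inner_def]

theorem CordesCondition.existsUnique_isVarSol (h : CordesCondition δ A b)
    (hδ : 1 / (1 + (2 * Real.pi) ^ 2) < δ) (F : L2per n (Vec n)) {P : Submodule ℝ (H1per0 n)}
    (hP : IsClosed (P : Set (H1per0 n))) : ∃! ρ : H1per0 n, IsVarSol A b F P ρ := by
  simp only [h.isVarSol_iff]
  exact existsUnique_mem_of_isCoercive (h.isCoercive_formL hδ) (rhsL F) hP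

theorem CordesCondition.norm_div_sub_le (h : CordesCondition δ A b)
    (hδ : 1 / (1 + (2 * Real.pi) ^ 2) < δ) {F : L2per n (Vec n)} {P : Submodule ℝ (H1per0 n)}
    {ρ ρh w : H1per0 n} (hρ : IsVarSol A b F ⊤ ρ) (hρh : IsVarSol A b F P ρh) (hw : w ∈ P) :
    ‖div (ρ - ρh)‖ ≤ (1 + cordesConst δ) / (1 - cordesConst δ) * ‖D (ρ - w)‖ := by
  rw [h.isVarSol_iff] at hρ hρh
  exact (norm_div_le _).trans <|
    cea_of_seminorm ((normSeminorm ℝ _).comp (DL n).toLinearMap) (B := h.formL.toLinearMap₁₂)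
      (sub_pos.mpr (cordesConst_lt_one hδ)) h.le_formL_self h.abs_formL_le
      (fun v _ => hρ.2 v trivial) hρh.1 hρh.2 hw

end Form

section VeryWeakSolutions

variable {n : ℕ} {δ : ℝ} {A : (Fin n → ℝ) → Matrix (Fin n) (Fin n) ℝ} {b : (Fin n → ℝ) → Vec n}
  {F : L2per n (Vec n)}

theorem CordesCondition.isVeryWeakSol_iff (h : CordesCondition δ A b) {u : L2per n ℝ} :
    IsVeryWeakSol A b F u ↔
      (∀ w ∈ gradients n, inner ℝ u (div w + h.pertL w) = inner ℝ F (fn w)) ∧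
        ∫ x, u x ∂(μY n) = 0 := by
  refine and_congr_left fun _ => ⟨?_, fun hu φ g H hg hH => ?_⟩
  · rintro hu w ⟨φ, hφ⟩
    rw [← h.integral_mul_renOp, hu φ (fn w) (D w) hφ w.2.1, L2.inner_def]
  · obtain ⟨w, hw, rfl, rfl⟩ := exists_mem_gradients hg hH
    rw [h.integral_mul_renOp, hu w hw, L2.inner_def]

theorem CordesCondition.isVeryWeakSol_neg_div (h : CordesCondition δ A b) {ρ : H1per0 n}
    (hρ : IsVarSol A b F ⊤ ρ) : IsVeryWeakSol A b F (-div ρ) := by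
  refine h.isVeryWeakSol_iff.mpr ⟨fun w hw => ?_, ?_⟩
  · have hform := (h.isVarSol_iff.mp hρ).2 w trivial
    rw [h.formL_apply, inner_D_D_of_mem_gradients ρ hw, ← inner_add_right, rhsL_apply] at hform
    rw [inner_neg_left, hform, neg_neg]
  · rw [integral_eq_inner_one, inner_neg_left, ← integral_eq_inner_one, integral_div, neg_zero]

theorem CordesCondition.eq_zero_of_forall_gradients (h : CordesCondition δ A b)
    (hδ : 1 / (1 + (2 * Real.pi) ^ 2) < δ) {u : L2per n ℝ} (hmean : ∫ x, u x ∂(μY n) = 0)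
    (hu : ∀ w ∈ gradients n, inner ℝ u (div w + h.pertL w) = 0) : u = 0 := by
  have hle (f : L2per n ℝ) (hf : f ∈ (gradients n).map (divL n).toLinearMap) :
      |inner ℝ u f| ≤ cordesConst δ * (‖u‖ * ‖f‖) := by
    obtain ⟨w, hw, rfl⟩ := hf
    have hpert : inner ℝ u (div w) = -inner ℝ u (h.pertL w) :=
      eq_neg_of_add_eq_zero_left ((inner_add_right _ _ _).symm.trans (hu w hw))
    change |inner ℝ u (div w)| ≤ cordesConst δ * (‖u‖ * ‖div w‖)
    rw [hpert, abs_neg, ← norm_D_of_mem_gradients hw]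
    exact h.abs_inner_pertL_le u w
  have hclosed : IsClosed {f : L2per n ℝ | |inner ℝ u f| ≤ cordesConst δ * (‖u‖ * ‖f‖)} :=
    isClosed_le (by fun_prop) (by fun_prop)
  have hself : |inner ℝ u u| ≤ cordesConst δ * (‖u‖ * ‖u‖) :=
    closure_minimal hle hclosed (mem_closure_map_divL_gradients hmean)
  rw [real_inner_self_eq_norm_mul_norm, abs_mul_self] at hself
  by_contra hne
  have hpos : 0 < ‖u‖ * ‖u‖ := by positivity
  exact hself.not_gt (mul_lt_of_lt_one_left hpos (cordesConst_lt_one hδ))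

theorem CordesCondition.isVeryWeakSol_unique (h : CordesCondition δ A b)
    (hδ : 1 / (1 + (2 * Real.pi) ^ 2) < δ) {u v : L2per n ℝ} (hu : IsVeryWeakSol A b F u)
    (hv : IsVeryWeakSol A b F v) : u = v := by
  rw [h.isVeryWeakSol_iff] at hu hv
  refine sub_eq_zero.mp (h.eq_zero_of_forall_gradients hδ ?_ fun w hw => ?_)
  · rw [integral_eq_inner_one, inner_sub_left, ← integral_eq_inner_one, ← integral_eq_inner_one,
      hu.2, hv.2, sub_self]
  · rw [inner_sub_left, hu.1 w hw, hv.1 w hw, sub_self]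

end VeryWeakSolutions

section SettingB

variable {n : ℕ} {lam Lam δ : ℝ} {A : (Fin n → ℝ) → Matrix (Fin n) (Fin n) ℝ}
  {b : (Fin n → ℝ) → Vec n}

theorem SettingB.trace_pos (hn : 0 < n) (h : SettingB lam Lam δ A b) :
    ∀ᵐ x, 0 < (A x).trace := by
  have : Nonempty (Fin n) := ⟨⟨0, hn⟩⟩
  filter_upwards [h.elliptic] with x hx
  refine Finset.sum_pos (fun i _ => h.lam_pos.trans_le ?_) Finset.univ_nonempty
  simpa using (hx (Pi.single i 1)).1

theorem SettingB.cordesCondition (hn : 0 < n) (h : SettingB lam Lam δ A b) :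
    CordesCondition δ A b where
  aemeasurable_A i j := (h.linfty_A i j).1.1.aemeasurable.restrict
  aemeasurable_b i := (h.linfty_b i).1.1.aemeasurable.restrict
  trace_ne_zero := ae_restrict_of_ae ((h.trace_pos hn).mono fun _ hx => hx.ne')
  cordes := ae_restrict_of_ae h.cordes

theorem one_div_one_add_two_pi_sq_lt (hn : 0 < n) :
    1 / (1 + (2 * Real.pi) ^ 2) < (n : ℝ) / (n + Real.pi ^ 2) := by
  have hn_one : (1 : ℝ) ≤ n := by exact_mod_cast hn
  have hpi : 0 < Real.pi ^ 2 := by positivity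
  rw [div_lt_div_iff₀ (by positivity) (by positivity)]
  nlinarith

end SettingB

end

end FPK

theorem theorem3p4_general {n : ℕ} {δ : ℝ} (hδ : 1 / (1 + (2 * Real.pi) ^ 2) < δ)
    {A : (Fin n → ℝ) → Matrix (Fin n) (Fin n) ℝ} {b : (Fin n → ℝ) → FPK.Vec n}
    (h : FPK.CordesCondition δ A b) (F : FPK.L2per n (FPK.Vec n)) :
    (∃! ρ₀ : FPK.H1per0 n, FPK.IsVarSol A b F ⊤ ρ₀) ∧
    (∃! u₀ : FPK.L2per n ℝ, FPK.IsVeryWeakSol A b F u₀) ∧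
    ∀ (ρ₀ : FPK.H1per0 n) (u₀ : FPK.L2per n ℝ),
      FPK.IsVarSol A b F ⊤ ρ₀ → FPK.IsVeryWeakSol A b F u₀ →
      u₀ = -FPK.div ρ₀ ∧
      ∀ P : Submodule ℝ (FPK.H1per0 n), IsClosed (P : Set (FPK.H1per0 n)) →
        (∃! ρh : FPK.H1per0 n, FPK.IsVarSol A b F P ρh) ∧
        ∀ ρh : FPK.H1per0 n, FPK.IsVarSol A b F P ρh →
          ‖u₀ - (-FPK.div ρh)‖ ≤ (1 + FPK.cordesConst δ) / (1 - FPK.cordesConst δ) *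
            ⨅ w : P, ‖FPK.D (ρ₀ - (w : FPK.H1per0 n))‖ := by
  have hexists := h.existsUnique_isVarSol hδ F (P := ⊤) isClosed_univ
  have hunique {u v : FPK.L2per n ℝ} (hu : FPK.IsVeryWeakSol A b F u)
      (hv : FPK.IsVeryWeakSol A b F v) : u = v := h.isVeryWeakSol_unique hδ hu hv
  refine ⟨hexists, ?_, fun ρ₀ u₀ hρ₀ hu₀ => ?_⟩
  · obtain ⟨ρ, hρ, -⟩ := hexists
    exact ⟨-FPK.div ρ, h.isVeryWeakSol_neg_div hρ, fun u hu =>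
      hunique hu (h.isVeryWeakSol_neg_div hρ)⟩
  · obtain rfl := hunique hu₀ (h.isVeryWeakSol_neg_div hρ₀)
    refine ⟨rfl, fun P hP => ⟨h.existsUnique_isVarSol hδ F hP, fun ρh hρh => ?_⟩⟩
    have herror : ‖-FPK.div ρ₀ - -FPK.div ρh‖ = ‖FPK.div (ρ₀ - ρh)‖ := by
      rw [neg_sub_neg, norm_sub_rev]
      exact congrArg norm (map_sub (FPK.divL n) ρ₀ ρh).symm
    rw [herror, Real.mul_iInf_of_nonneg (FPK.cea_ratio_pos hδ).le]
    exact le_ciInf fun w => h.norm_div_sub_le hδ hρ₀ hρh w.2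

theorem theorem3p4 (n : ℕ) (hn : 0 < n) (lam Lam δ : ℝ) :
    ∃ C : ℝ, 0 < C ∧
      ∀ (A : (Fin n → ℝ) → Matrix (Fin n) (Fin n) ℝ) (b : (Fin n → ℝ) → FPK.Vec n),
        FPK.SettingB lam Lam δ A b →
      ∀ F : FPK.L2per n (FPK.Vec n),
        (∃! ρ₀ : FPK.H1per0 n, FPK.IsVarSol A b F ⊤ ρ₀) ∧
        (∃! u₀ : FPK.L2per n ℝ, FPK.IsVeryWeakSol A b F u₀) ∧
        ∀ (ρ₀ : FPK.H1per0 n) (u₀ : FPK.L2per n ℝ),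
          FPK.IsVarSol A b F ⊤ ρ₀ → FPK.IsVeryWeakSol A b F u₀ →
          u₀ = -FPK.div ρ₀ ∧
          ∀ P : Submodule ℝ (FPK.H1per0 n), IsClosed (P : Set (FPK.H1per0 n)) →
            (∃! ρh : FPK.H1per0 n, FPK.IsVarSol A b F P ρh) ∧
            ∀ ρh : FPK.H1per0 n, FPK.IsVarSol A b F P ρh →
              ‖u₀ - (-FPK.div ρh)‖ ≤ C * ⨅ w : P, ‖FPK.D (ρ₀ - (w : FPK.H1per0 n))‖ := by
  by_cases hδ : (n : ℝ) / (n + Real.pi ^ 2) < δ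
  · have hδ_weak := (FPK.one_div_one_add_two_pi_sq_lt hn).trans hδ
    exact ⟨_, FPK.cea_ratio_pos hδ_weak, fun A b h F =>
      theorem3p4_general hδ_weak (h.cordesCondition hn) F⟩
  · exact ⟨1, one_pos, fun A b h => absurd h.lt_δ hδ⟩
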